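/- Let $k$ be a perfect field of characteristic $p>0$, let $A=k[x_1,\ldots,x_n]$ with homogeneous maximal ideal $m_A=(x_1,\ldots,x_n)$, and let $T\cong\mathbb N^n$ be the semigroup of monomials of $A$. Let $S\subseteq T$ be a finitely generated subsemigroup containing $1$, let $R=k[S]\subseteq A$ be the monomial subring it spans, and let $d=\dim R$. Assume that - $S$ is full: if $L\subseteq\mathbb Z^n$ denotes the group generated by (the exponent vectors of) $S$, then $L\cap T=S$; and - $S$ satisfies property $(*)$: for every variable $x_i$ there are monomials $\zeta,\eta\in S$ such that the fraction $\zeta/\eta$, written in lowest terms in $\operatorname{Frac}(A)$, equals $\tau/x_i$ for some monomial $\tau\in T$ (not necessarily in $S$). For $e\ge 0$ let $F^e_*R$ be the abelian group $R$ with the $R$-module structure $r\cdot s=r^{p^e}s$, graded by total degree, and let $a_e$ be its free rank, i.e. the number of summands isomorphic to $R$ in a decomposition of $F^e_*R$ as a finite direct sum of indecomposable graded $R$-submodules. For an ideal $I\subseteq A$ let $I^{[p^e]}$ be the ideal of $A$ generated by the $p^e$-th powers of the elements of $I$, and let $l$ denote length over $R$. Then $a_e$ is well defined (such a decomposition exists,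 and the number of summands isomorphic to $R$ is the same in all of them), $$a_e=l\bigl(R/(m_A^{[p^e]}\cap R)\bigr)\quad\text{for all } e\ge 0,$$ the limit $s(R)=\lim_{e\to\infty}a_e/p^{ed}$ defining the $F$-signature of $R$ exists, and $$s(R)=\lim_{e\to\infty}\frac{l\bigl(R/(m_A^{[p^e]}\cap R)\bigr)}{p^{ed}}.$$ -/

import Mathlib

open Filter Topology

noncomputable section

namespace MonomialRing

/-! ### Semigroups of monomials (a monomial of `k[x₁,…,xₙ]` is its exponent vector) -/

/-- The lattice in `ℤⁿ` generated by a semigroup `S ⊆ ℕⁿ` of exponent vectors. -/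
def lattice {n : ℕ} (S : AddSubmonoid (Fin n →₀ ℕ)) : AddSubgroup (Fin n → ℤ) :=
  AddSubgroup.closure ((fun s i => (s i : ℤ)) '' (S : Set (Fin n →₀ ℕ)))

/-- `S` is full: `Lattice(S) ∩ ℕⁿ = S`. -/
def IsFull {n : ℕ} (S : AddSubmonoid (Fin n →₀ ℕ)) : Prop :=
  ∀ t : Fin n →₀ ℕ, (fun i => (t i : ℤ)) ∈ lattice S ↔ t ∈ S

/-- Property `(*)`: for every variable `xᵢ` there are monomials `ζ, η ∈ S` whose quotient `ζ / η`,
in lowest terms, is `τ / xᵢ` with `τ` a monomial in `x₁,…,xₙ`. In exponents `ζ + eᵢ = η + τ`, and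
"lowest terms" means that `xᵢ` does not divide `τ`. -/
def PropertyStar {n : ℕ} (S : AddSubmonoid (Fin n →₀ ℕ)) : Prop :=
  ∀ i : Fin n, ∃ ζ ∈ S, ∃ η ∈ S, ∃ τ : Fin n →₀ ℕ,
    τ i = 0 ∧ ζ + Finsupp.single i 1 = η + τ

/-- The monomial ring `k[S] ⊆ k[x₁,…,xₙ]`. -/
def monomialSubring (k : Type*) [Field k] {n : ℕ} (S : AddSubmonoid (Fin n →₀ ℕ)) :
    Subalgebra k (MvPolynomial (Fin n) k) :=
  Algebra.adjoin k ((fun s => MvPolynomial.monomial s (1 : k)) '' (S : Set (Fin n →₀ ℕ)))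

/-- The homogeneous maximal ideal `(x₁,…,xₙ)` of `k[x₁,…,xₙ]`. -/
def homogeneousMaximalIdeal (k : Type*) [Field k] (n : ℕ) : Ideal (MvPolynomial (Fin n) k) :=
  Ideal.span (Set.range MvPolynomial.X)

/-- `I^{[q]}`, the ideal generated by the `q`-th powers of the elements of `I`. -/
def bracketPower {A : Type*} [CommRing A] (I : Ideal A) (q : ℕ) : Ideal A :=
  Ideal.span ((fun x => x ^ q) '' (I : Set A))

/-! ### The Frobenius push-forward -/

/-- `F^e_* R`: the abelian group `R`, with the `R`-module structure `r • s = r ^ (p ^ e) * s`. -/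
def FrobeniusPushforward (R : Type*) (_p _e : ℕ) : Type _ := R

instance (R : Type*) [CommRing R] (p e : ℕ) : AddCommGroup (FrobeniusPushforward R p e) :=
  inferInstanceAs (AddCommGroup R)

instance (R : Type*) [CommRing R] (p e : ℕ) [ExpChar R p] :
    Module R (FrobeniusPushforward R p e) :=
  letI : Module R R := Semiring.toModule
  (Module.compHom R (iterateFrobenius R p e) : Module R R)

theorem FrobeniusPushforward.smul_def (R : Type*) [CommRing R] (p e : ℕ) [ExpChar R p]
    (r : R) (s : FrobeniusPushforward R p e) :
    r • s = (r ^ p ^ e * (show R from s) : R) := rfl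

instance (k : Type*) [Field k] (p : ℕ) [ExpChar k p] {n : ℕ} (S : AddSubmonoid (Fin n →₀ ℕ)) :
    ExpChar (monomialSubring k S) p :=
  expChar_of_injective_algebraMap (algebraMap k (monomialSubring k S)).injective p

/-! ### Free rank of a graded module -/

section FreeRank

variable (R : Type*) [CommRing R] {M : Type*} [AddCommGroup M] [Module R M]

/-- A submodule is indecomposable if it is nonzero and is not the direct sum of two nonzero
submodules. -/
def IsIndecomposable (N : Submodule R M) : Prop :=
  N ≠ ⊥ ∧ ∀ A B : Submodule R M, A ⊔ B = N → Disjoint A B → A = ⊥ ∨ B = ⊥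

/-- `H` is the set of homogeneous elements of the graded module `M`. The natural number `a` is a
free rank of `M` if `M` is a finite direct sum of indecomposable graded submodules (that is,
submodules generated by homogeneous elements), of which exactly `a` are isomorphic to `R`. -/
def IsFreeRank (H : Set M) (a : ℕ) : Prop :=
  ∃ (s : ℕ) (N : Fin s → Submodule R M),
    DirectSum.IsInternal N ∧
    (∀ i, Submodule.span R (H ∩ (N i : Set M)) = N i) ∧
    (∀ i, IsIndecomposable R (N i)) ∧
    a = Nat.card {i : Fin s // Nonempty (N i ≃ₗ[R] R)}

/-- The free rank of a graded module with set of homogeneous elements `H`; it is meaningful when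
exactly one number satisfies `IsFreeRank`. -/
def freeRank (H : Set M) : ℕ := sSup {a : ℕ | IsFreeRank R H a}

end FreeRank

/-! ### `F`-signature of a monomial ring over a perfect field -/

/-- The homogeneous elements of `F^e_* k[S]`, for the grading by total degree. -/
def homogeneousElements (k : Type*) [Field k] (p e : ℕ) {n : ℕ} (S : AddSubmonoid (Fin n →₀ ℕ)) :
    Set (FrobeniusPushforward (monomialSubring k S) p e) :=
  {f | ∃ j : ℕ, ((show monomialSubring k S from f) : MvPolynomial (Fin n) k).IsHomogeneous j}

/-- `a_e`, the free rank of `F^e_* R` as an `R`-module, for `R = k[S]`. -/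
def frobeniusFreeRank (k : Type*) [Field k] (p : ℕ) [ExpChar k p] {n : ℕ}
    (S : AddSubmonoid (Fin n →₀ ℕ)) (e : ℕ) : ℕ :=
  freeRank (monomialSubring k S) (homogeneousElements k p e S)

/-- The Krull dimension as a natural number (for a nonzero ring of finite dimension). -/
def dim (R : Type*) [CommRing R] : ℕ := ((ringKrullDim R).unbotD 0).toNat

/-- The `F`-signature `s(R) = lim a_e / p ^ (e d)` of `R = k[S]`, where `k` is perfect. -/
def fSignature (k : Type*) [Field k] (p : ℕ) [ExpChar k p] {n : ℕ}
    (S : AddSubmonoid (Fin n →₀ ℕ)) : ℝ :=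
  limUnder atTop fun e : ℕ =>
    (frobeniusFreeRank k p S e : ℝ) / (p : ℝ) ^ (e * dim (monomialSubring k S))

/-- The length of the `R`-module `R / I`. -/
def quotientLength {R : Type*} [CommRing R] (I : Ideal R) : ℕ∞ := Module.length R (R ⧸ I)

/-- The length of the `R`-module `R / (m_A^{[q]} ∩ R)`, where `R = k[S] ⊆ A = k[x₁,…,xₙ]`. -/
def bracketLength (k : Type*) [Field k] {n : ℕ} (S : AddSubmonoid (Fin n →₀ ℕ)) (q : ℕ) : ℕ∞ :=
  quotientLength ((bracketPower (homogeneousMaximalIdeal k n) q).comap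
    (algebraMap (monomialSubring k S) (MvPolynomial (Fin n) k)))

end MonomialRing

end

namespace MonomialRing

/-! ### Free rank and its independence of the decomposition. -/

section KrullSchmidt

variable {R : Type*} [CommRing R] {M : Type*} [AddCommGroup M] [Module R M]

/-! Put q = p^e. Both sides of the formula count the `box`: the elements of S with all exponents <
q.

Free rank: F^e_*R is the direct sum of the submodules spanned by the monomials of a fixed class
modulo qL. Each has rank one, hence is indecomposable. If s in the box and t in S have the same
class, then t = s + qw with w in L, and t ≥ 0 with s_i < q forces w ≥ 0; fullness puts w in S, and
since k has q-th roots the summand is free on x^s (`nonempty_equiv_of_mem_box`). Conversely, a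
generator of a free summand divides every monomial of its class, so it is itself a monomial;
property (*) would lower any exponent ≥ q within the class, so the generator lies in the box
(`exists_mem_box_of_equiv`).

Uniqueness: R is not local, but a functional taking a homogeneous h outside the irrelevant ideal m
has a graded component taking h to a nonzero constant. So the number of free summands is the length
of M modulo the elements that all functionals send into m (`IsFreeRank.length_eq`), which depends on
no decomposition.

Length: m_A^[q] ∩ R consists of the elements with no term in the box, and box monomials can be
removed one at a time in decreasing degree (`quotientLength_vanishingIdeal`).

Limit: the box is the set of points of L in [0,q)^n, so its size over q^r, with r the rank of L,
tends to the volume of a bounded convex set. Only r ≤ d is needed: if r < d, the limit would be 0.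
-/

/-- Since ψ h is a unit, N = Rh ⊕ (N ∩ ker ψ) and h has zero annihilator; indecomposability kills
the second summand. -/
theorem IsIndecomposable.nonempty_equiv_of_isUnit [Nontrivial R] {N : Submodule R M}
    (hN : IsIndecomposable R N) {h : M} (hh : h ∈ N) (ψ : M →ₗ[R] R) (hu : IsUnit (ψ h)) :
    Nonempty (N ≃ₗ[R] R) := by
  obtain ⟨u, hu⟩ := hu
  have hsmul : ∀ r : R, r • h = 0 → r = 0 := by
    intro r hr
    have := congrArg ψ hr
    rw [map_smul, map_zero, ← hu, smul_eq_mul] at this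
    simpa using this
  have hsup : Submodule.span R {h} ⊔ (N ⊓ LinearMap.ker ψ) = N := by
    apply le_antisymm
    · refine sup_le ?_ inf_le_left
      rwa [Submodule.span_singleton_le_iff_mem]
    · intro x hx
      rw [Submodule.mem_sup]
      refine ⟨(ψ x * (u⁻¹ : Rˣ)) • h, Submodule.smul_mem _ _ (Submodule.mem_span_singleton_self h),
        x - (ψ x * (u⁻¹ : Rˣ)) • h, ⟨N.sub_mem hx (N.smul_mem _ hh), ?_⟩, by abel⟩
      change ψ _ = 0
      rw [map_sub, map_smul, ← hu, smul_eq_mul]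
      simp [mul_assoc]
  have hdisj : Disjoint (Submodule.span R {h}) (N ⊓ LinearMap.ker ψ) := by
    rw [Submodule.disjoint_def]
    intro x hx hx'
    obtain ⟨r, rfl⟩ := Submodule.mem_span_singleton.mp hx
    have : ψ (r • h) = 0 := hx'.2
    rw [map_smul, ← hu, smul_eq_mul, Units.mul_left_eq_zero] at this
    rw [this, zero_smul]
  rcases hN.2 _ _ hsup hdisj with h0 | h0
  · rw [Submodule.span_singleton_eq_bot] at h0
    exact absurd (hsmul 1 (by simp [h0])) one_ne_zero
  · rw [h0, sup_bot_eq] at hsup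
    let f : R →ₗ[R] N := LinearMap.toSpanSingleton R N ⟨h, hh⟩
    refine ⟨(LinearEquiv.ofBijective f ⟨?_, ?_⟩).symm⟩
    · rw [injective_iff_map_eq_zero]
      intro r hr
      exact hsmul r (congrArg Subtype.val hr)
    · rintro ⟨x, hx⟩
      rw [← hsup] at hx
      obtain ⟨r, rfl⟩ := Submodule.mem_span_singleton.mp hx
      exact ⟨r, rfl⟩

/-- The hypothesis `hgr` stands in for locality of R; it suffices on homogeneous elements because
they generate N. -/
theorem map_mem_of_not_nonempty_equiv {m : Ideal R} [m.IsMaximal] {H : Set M}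
    (hgr : ∀ (φ : M →ₗ[R] R), ∀ h ∈ H, φ h ∉ m → ∃ ψ : M →ₗ[R] R, IsUnit (ψ h))
    {N : Submodule R M} (hN : IsIndecomposable R N)
    (hspan : Submodule.span R (H ∩ (N : Set M)) = N) (hfree : ¬ Nonempty (N ≃ₗ[R] R))
    (φ : M →ₗ[R] R) {x : M} (hx : x ∈ N) : φ x ∈ m := by
  have : Nontrivial R := ⟨0, 1, fun h =>
    Ideal.IsPrime.ne_top' (I := m) (m.eq_top_iff_one.mpr (h ▸ m.zero_mem))⟩
  suffices h : Submodule.span R (H ∩ (N : Set M)) ≤ Submodule.comap φ m from h (hspan.symm ▸ hx)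
  rw [Submodule.span_le]
  rintro h ⟨hH, hhN⟩
  by_contra hm
  obtain ⟨ψ, hψ⟩ := hgr φ h hH hm
  exact hfree (hN.nonempty_equiv_of_isUnit hhN ψ hψ)

/-- The submodule of elements sent into `m` by every linear functional. -/
def nonsplitSubmodule (M : Type*) [AddCommGroup M] [Module R M] (m : Ideal R) : Submodule R M :=
  ⨅ φ : M →ₗ[R] R, Submodule.comap φ m

/-- The coordinates on the free summands, reduced modulo m, map M onto (R/m)^a. The kernel is
`nonsplitSubmodule M m` because nonfree summands always go into m. -/
theorem IsFreeRank.length_eq {m : Ideal R} [m.IsMaximal] {H : Set M}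
    (hgr : ∀ (φ : M →ₗ[R] R), ∀ h ∈ H, φ h ∉ m → ∃ ψ : M →ₗ[R] R, IsUnit (ψ h))
    {a : ℕ} (ha : IsFreeRank R H a) :
    Module.length R (M ⧸ nonsplitSubmodule M m) = a := by
  classical
  obtain ⟨s, N, hint, hspan, hind, rfl⟩ := ha
  let e := LinearEquiv.ofBijective (DirectSum.coeLinearMap N) hint
  let π : ∀ i, M →ₗ[R] N i := fun i => DirectSum.component R (Fin s) (fun i => N i) i ∘ₗ e.symm
  have hπ : ∀ x, x = ∑ i, (π i x : M) := by
    intro x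
    conv_lhs => rw [← e.apply_symm_apply x]
    change DirectSum.coeLinearMap N (e.symm x) = _
    conv_lhs => rw [← DirectSum.sum_univ_of (e.symm x)]
    rw [map_sum]
    refine Finset.sum_congr rfl fun i _ => ?_
    exact DirectSum.coeLinearMap_lof N i _
  have hπN : ∀ i j (x : N i), π j (x : M) = if h : i = j then h ▸ x else 0 := by
    intro i j x
    have : e.symm (x : M) = DirectSum.lof R _ (fun i => N i) i x := by
      rw [LinearEquiv.symm_apply_eq]
      exact (DirectSum.coeLinearMap_lof N i _).symm
    change DirectSum.component R (Fin s) (fun i => N i) j (e.symm (x : M)) = _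
    rw [this, DirectSum.component.of]
  let I := {i : Fin s // Nonempty (N i ≃ₗ[R] R)}
  let ε : ∀ i : I, N i ≃ₗ[R] R := fun i => i.2.some
  let Φ : M →ₗ[R] (I → R ⧸ m) :=
    LinearMap.pi fun i => (Submodule.mkQ m) ∘ₗ (ε i).toLinearMap ∘ₗ π i
  have hΦ : ∀ x i, Φ x i = Submodule.Quotient.mk (ε i (π i x)) := fun _ _ => rfl
  have hsurj : Function.Surjective Φ := by
    intro c
    choose r hr using fun i => Submodule.Quotient.mk_surjective m (c i)
    refine ⟨∑ i, ((ε i).symm (r i) : M), ?_⟩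
    ext j
    rw [map_sum, Finset.sum_apply, Finset.sum_eq_single j]
    · rw [hΦ, hπN, dif_pos rfl, LinearEquiv.apply_symm_apply, hr]
    · intro i _ hij
      rw [hΦ, hπN, dif_neg (fun h => hij (Subtype.ext h)), map_zero]
      rfl
    · simp
  have hker : LinearMap.ker Φ = nonsplitSubmodule M m := by
    ext x
    simp only [nonsplitSubmodule, LinearMap.mem_ker, Submodule.mem_iInf, Submodule.mem_comap]
    have hx0 : Φ x = 0 ↔ ∀ i, ε i (π i x) ∈ m := by
      rw [funext_iff]
      refine forall_congr' fun i => ?_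
      rw [hΦ]
      exact Submodule.Quotient.mk_eq_zero m
    rw [hx0]
    constructor
    · intro h φ
      rw [hπ x, map_sum]
      refine m.sum_mem fun i _ => ?_
      by_cases hi : Nonempty (N i ≃ₗ[R] R)
      · have h1 : (π i x : M) = ε ⟨i, hi⟩ (π i x) • ((ε ⟨i, hi⟩).symm 1 : M) := by
          rw [← Submodule.coe_smul, ← map_smul, smul_eq_mul, mul_one, LinearEquiv.symm_apply_apply]
        rw [h1, map_smul, smul_eq_mul]
        exact m.mul_mem_right _ (h ⟨i, hi⟩)
      · exact map_mem_of_not_nonempty_equiv hgr (hind i) (hspan i) hi φ (π i x).2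
    · intro h i
      exact h ((ε i).toLinearMap ∘ₗ π i)
  rw [← hker, (Φ.quotKerEquivOfSurjective hsurj).length_eq]
  have hsimple : IsSimpleModule R (R ⧸ m) := isSimpleModule_iff_isCoatom.mpr Ideal.IsMaximal.out
  rw [Module.length_pi, Module.length_eq_one, mul_one]
  exact ENat.card_eq_coe_natCard _

theorem IsFreeRank.freeRank_eq {m : Ideal R} [m.IsMaximal] {H : Set M}
    (hgr : ∀ (φ : M →ₗ[R] R), ∀ h ∈ H, φ h ∉ m → ∃ ψ : M →ₗ[R] R, IsUnit (ψ h))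
    {a : ℕ} (ha : IsFreeRank R H a) :
    (∃! b : ℕ, IsFreeRank R H b) ∧ freeRank R H = a := by
  have huniq : ∀ b, IsFreeRank R H b → b = a := fun b hb =>
    Nat.cast_injective (R := ℕ∞) ((hb.length_eq hgr).symm.trans (ha.length_eq hgr))
  refine ⟨⟨a, ha, huniq⟩, ?_⟩
  have : {b : ℕ | IsFreeRank R H b} = {a} := Set.ext fun b => ⟨huniq b, fun h => h ▸ ha⟩
  rw [freeRank, this, csSup_singleton]

end KrullSchmidt

/-! ### Monomial subrings and their homogeneous components. -/

section Basic

variable {k : Type*} [Field k] {n : ℕ} {S : AddSubmonoid (Fin n →₀ ℕ)}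

theorem mem_monomialSubring_iff {f : MvPolynomial (Fin n) k} :
    f ∈ monomialSubring k S ↔ ∀ s ∈ f.support, s ∈ S := by
  classical
  constructor
  · intro hf
    induction hf using Algebra.adjoin_induction with
    | mem x hx =>
      obtain ⟨s, hs, rfl⟩ := hx
      intro t ht
      rw [Finset.mem_singleton.mp (MvPolynomial.support_monomial_subset ht)]
      exact hs
    | algebraMap r =>
      intro t ht
      rw [Finset.mem_singleton.mp (MvPolynomial.support_monomial_subset ht)]
      exact S.zero_mem
    | add x y _ _ hx hy =>
      intro t ht
      rcases Finset.mem_union.mp (MvPolynomial.support_add ht) with h | h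
      exacts [hx t h, hy t h]
    | mul x y _ _ hx hy =>
      intro t ht
      obtain ⟨u, hu, v, hv, rfl⟩ := Finset.mem_add.mp (MvPolynomial.support_mul x y ht)
      exact S.add_mem (hx u hu) (hy v hv)
  · intro h
    rw [f.as_sum]
    refine Subalgebra.sum_mem _ fun s hs => ?_
    rw [← mul_one (f.coeff s), ← smul_eq_mul, ← MvPolynomial.smul_monomial]
    exact Subalgebra.smul_mem _ (Algebra.subset_adjoin (Set.mem_image_of_mem _ (h s hs))) _

theorem coeff_eq_zero_of_notMem (f : monomialSubring k S) {s : Fin n →₀ ℕ} (hs : s ∉ S) :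
    (f : MvPolynomial (Fin n) k).coeff s = 0 := by
  by_contra h
  exact hs (mem_monomialSubring_iff.mp f.2 s (MvPolynomial.mem_support_iff.mpr h))

theorem monomial_mem_monomialSubring {s : Fin n →₀ ℕ} (hs : s ∈ S) (c : k) :
    MvPolynomial.monomial s c ∈ monomialSubring k S := by
  rw [mem_monomialSubring_iff]
  intro t ht
  rwa [Finset.mem_singleton.mp (MvPolynomial.support_monomial_subset ht)]

/-- The ideal of the elements of `k[S]` without constant term. -/
noncomputable def irrelevantIdeal (k : Type*) [Field k] {n : ℕ} (S : AddSubmonoid (Fin n →₀ ℕ)) :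
    Ideal (monomialSubring k S) :=
  RingHom.ker ((MvPolynomial.constantCoeff (R := k) (σ := Fin n)).comp
    (monomialSubring k S).val.toRingHom)

theorem mem_irrelevantIdeal {f : monomialSubring k S} :
    f ∈ irrelevantIdeal k S ↔ (f : MvPolynomial (Fin n) k).coeff 0 = 0 := Iff.rfl

instance : (irrelevantIdeal k S).IsMaximal := by
  refine RingHom.ker_isMaximal_of_surjective _ fun c => ?_
  exact ⟨⟨MvPolynomial.monomial 0 c, monomial_mem_monomialSubring S.zero_mem c⟩,
    MvPolynomial.constantCoeff_C _ c⟩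

theorem homogeneousComponent_mul_of_isHomogeneous {r : MvPolynomial (Fin n) k} {j : ℕ}
    (hr : r.IsHomogeneous j) (y : MvPolynomial (Fin n) k) (i : ℕ) :
    MvPolynomial.homogeneousComponent i (r * y) =
      if j ≤ i then r * MvPolynomial.homogeneousComponent (i - j) y else 0 := by
  conv_lhs => rw [← y.sum_homogeneousComponent, Finset.mul_sum, map_sum]
  have h1 : ∀ l, MvPolynomial.homogeneousComponent i
      (r * MvPolynomial.homogeneousComponent l y) =
      if j + l = i then r * MvPolynomial.homogeneousComponent l y else 0 := by
    intro l
    rw [MvPolynomial.homogeneousComponent_of_mem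
      ((MvPolynomial.mem_homogeneousSubmodule _ _).mpr
        (hr.mul (MvPolynomial.homogeneousComponent_isHomogeneous l y)))]
    simp_rw [eq_comm]
  simp_rw [h1]
  split_ifs with hji
  · rw [Finset.sum_eq_single (i - j)]
    · rw [if_pos (by omega)]
    · intro l _ hl
      rw [if_neg (by omega)]
    · intro hl
      rw [if_pos (by omega), MvPolynomial.homogeneousComponent_eq_zero, mul_zero]
      rw [Finset.mem_range] at hl
      omega
  · exact Finset.sum_eq_zero fun l _ => if_neg (by omega)

/-- The component of degree `i` of an element of `k[S]`. -/
noncomputable def component (S : AddSubmonoid (Fin n →₀ ℕ)) (i : ℕ) :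
    monomialSubring k S →+ monomialSubring k S where
  toFun f := ⟨MvPolynomial.homogeneousComponent i f.1, by
    rw [mem_monomialSubring_iff]
    intro s hs
    rw [MvPolynomial.support_homogeneousComponent] at hs
    exact mem_monomialSubring_iff.mp f.2 s (Finset.mem_of_mem_filter s hs)⟩
  map_zero' := Subtype.ext (map_zero _)
  map_add' f g := Subtype.ext (map_add _ f.1 g.1)

theorem sum_component (f : monomialSubring k S) :
    ∑ i ∈ Finset.range ((f : MvPolynomial (Fin n) k).totalDegree + 1), component S i f = f := by
  apply Subtype.ext
  rw [AddSubmonoidClass.coe_finsetSum]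
  exact MvPolynomial.sum_homogeneousComponent _

theorem component_mul {r : monomialSubring k S} {j : ℕ}
    (hr : (r : MvPolynomial (Fin n) k).IsHomogeneous j) (y : monomialSubring k S) (i : ℕ) :
    component S i (r * y) = if j ≤ i then r * component S (i - j) y else 0 := by
  apply Subtype.ext
  have := homogeneousComponent_mul_of_isHomogeneous hr y i
  split_ifs with h
  · rw [if_pos h] at this
    exact this
  · rw [if_neg h] at this
    exact this

end Basic

/-! ### Graded components of functionals on the Frobenius push-forward. -/

section PushforwardValue

variable {k : Type*} [Field k] {n : ℕ} {S : AddSubmonoid (Fin n →₀ ℕ)} {p e : ℕ}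

/-- The polynomial underlying an element of `F^e_* k[S]`. -/
noncomputable def polynomial : FrobeniusPushforward (monomialSubring k S) p e →+ MvPolynomial (Fin n) k :=
  ((monomialSubring k S).val : monomialSubring k S →+ MvPolynomial (Fin n) k)

theorem polynomial_injective :
    Function.Injective (polynomial (k := k) (S := S) (p := p) (e := e)) :=
  Subtype.val_injective

theorem polynomial_smul [ExpChar k p] (r : monomialSubring k S)
    (x : FrobeniusPushforward (monomialSubring k S) p e) :
    polynomial (r • x) = (r : MvPolynomial (Fin n) k) ^ p ^ e * polynomial x := rfl

theorem mem_of_mem_support_polynomial {x : FrobeniusPushforward (monomialSubring k S) p e}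
    {s : Fin n →₀ ℕ} (hs : s ∈ (polynomial x).support) : s ∈ S :=
  mem_monomialSubring_iff.mp (show monomialSubring k S from x).2 s hs

theorem mem_homogeneousElements {x : FrobeniusPushforward (monomialSubring k S) p e} :
    x ∈ homogeneousElements k p e S ↔ ∃ j, (polynomial x).IsHomogeneous j := Iff.rfl

/-- The component of degree `i` of an element of `F^e_* k[S]`. -/
noncomputable def pushComponent (i : ℕ) : FrobeniusPushforward (monomialSubring k S) p e →+
    FrobeniusPushforward (monomialSubring k S) p e :=
  component S i

theorem polynomial_pushComponent (i : ℕ) (x : FrobeniusPushforward (monomialSubring k S) p e) :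
    polynomial (pushComponent i x) = MvPolynomial.homogeneousComponent i (polynomial x) := rfl

theorem pushComponent_smul [ExpChar k p] {r : monomialSubring k S} {j : ℕ}
    (hr : (r : MvPolynomial (Fin n) k).IsHomogeneous j)
    (x : FrobeniusPushforward (monomialSubring k S) p e) (i : ℕ) :
    pushComponent i (r • x) = if j * p ^ e ≤ i then r • pushComponent (i - j * p ^ e) x else 0 := by
  apply polynomial_injective
  rw [polynomial_pushComponent, polynomial_smul,
    homogeneousComponent_mul_of_isHomogeneous (hr.pow (p ^ e))]
  split_ifs
  · rfl
  · rw [map_zero]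

variable [ExpChar k p] (φ : FrobeniusPushforward (monomialSubring k S) p e →ₗ[monomialSubring k S]
  monomialSubring k S) (j : ℕ)

/-- The part of degree `i` of the graded component of a linear functional on `F^e_* k[S]` that
sends elements of degree `j` to constants. -/
noncomputable def gradedPart (i : ℕ) : FrobeniusPushforward (monomialSubring k S) p e →+ monomialSubring k S :=
  (component S i).comp (φ.toAddMonoidHom.comp (pushComponent (j + i * p ^ e)))

theorem gradedPart_apply (i : ℕ) (x : FrobeniusPushforward (monomialSubring k S) p e) :
    gradedPart φ j i x = component S i (φ (pushComponent (j + i * p ^ e) x)) := rfl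

theorem gradedPart_eq_zero {i : ℕ} {x : FrobeniusPushforward (monomialSubring k S) p e}
    (h : (polynomial x).totalDegree < i) : gradedPart φ j i x = 0 := by
  have : pushComponent (j + i * p ^ e) x = 0 := by
    apply polynomial_injective
    rw [polynomial_pushComponent, map_zero, MvPolynomial.homogeneousComponent_eq_zero]
    have : 0 < p ^ e := pow_pos (expChar_pos k p) e
    nlinarith
  rw [gradedPart_apply, this, map_zero, map_zero]

theorem gradedPart_smul {r : monomialSubring k S} {l : ℕ}
    (hr : (r : MvPolynomial (Fin n) k).IsHomogeneous l)
    (x : FrobeniusPushforward (monomialSubring k S) p e) (i : ℕ) :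
    gradedPart φ j i (r • x) = if l ≤ i then r * gradedPart φ j (i - l) x else 0 := by
  rw [gradedPart_apply, pushComponent_smul hr]
  split_ifs with h1 h2 h2
  · rw [map_smul, smul_eq_mul, component_mul hr, if_pos h2, gradedPart_apply]
    congr 5
    obtain ⟨d, rfl⟩ := Nat.exists_eq_add_of_le h2
    rw [Nat.add_sub_cancel_left, add_mul]
    omega
  -- For large j, l * p^e ≤ j + i * p^e can hold with l > i; the value is then a multiple of r,
  -- which has no part of degree i.
  · rw [map_smul, smul_eq_mul, component_mul hr, if_neg h2]
  · exact absurd (le_add_left (Nat.mul_le_mul_right _ h2)) h1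
  · rw [map_zero, map_zero]

theorem sum_gradedPart_eq {x : FrobeniusPushforward (monomialSubring k S) p e} {N : ℕ}
    (hN : (polynomial x).totalDegree < N) :
    ∑ i ∈ Finset.range N, gradedPart φ j i x = ∑ᶠ i, gradedPart φ j i x := by
  rw [finsum_eq_sum_of_support_subset]
  intro i hi
  by_contra h
  refine hi (gradedPart_eq_zero φ j ?_)
  simp only [Finset.coe_range, Set.mem_Iio, not_lt] at h
  omega

/-- The graded component, of the degree that sends elements of degree `j` to constants, of a
linear functional on `F^e_* k[S]`. -/
noncomputable def gradedComponent :
    FrobeniusPushforward (monomialSubring k S) p e →ₗ[monomialSubring k S] monomialSubring k S :=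
  have hadd : ∀ x y, ∑ᶠ i, gradedPart φ j i (x + y) =
      ∑ᶠ i, gradedPart φ j i x + ∑ᶠ i, gradedPart φ j i y := by
    intro x y
    let N := (polynomial x).totalDegree + (polynomial y).totalDegree +
      (polynomial (x + y)).totalDegree + 1
    rw [← sum_gradedPart_eq φ j (N := N) (by omega), ← sum_gradedPart_eq φ j (N := N) (by omega),
      ← sum_gradedPart_eq φ j (N := N) (by omega), ← Finset.sum_add_distrib]
    exact Finset.sum_congr rfl fun i _ => map_add _ _ _
  let ψ : FrobeniusPushforward (monomialSubring k S) p e →+ monomialSubring k S :=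
    AddMonoidHom.mk' (fun x => ∑ᶠ i, gradedPart φ j i x) hadd
  have hψ : ∀ x, ψ x = ∑ᶠ i, gradedPart φ j i x := fun _ => rfl
  { ψ with
    map_smul' := by
      intro r x
      have hhom : ∀ l, ψ (component S l r • x) = component S l r * ψ x := by
        intro l
        let N := (polynomial x).totalDegree + (polynomial (component S l r • x)).totalDegree + 1
        rw [hψ, hψ, ← sum_gradedPart_eq φ j (N := l + N) (by omega),
          ← sum_gradedPart_eq φ j (N := N) (by omega), Finset.sum_range_add, Finset.mul_sum]
        have hr : (component S l r : MvPolynomial (Fin n) k).IsHomogeneous l :=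
          MvPolynomial.homogeneousComponent_isHomogeneous l _
        -- The first l terms vanish, as multiplication by an element of degree l shifts the index i
        -- by l.
        rw [Finset.sum_eq_zero, zero_add]
        · refine Finset.sum_congr rfl fun i _ => ?_
          rw [gradedPart_smul φ j hr, if_pos (by omega), Nat.add_sub_cancel_left]
        · intro i hi
          rw [gradedPart_smul φ j hr, if_neg (by simpa using hi)]
      change ψ (r • x) = r * ψ x
      conv_lhs => rw [← sum_component r]
      conv_rhs => rw [← sum_component r]
      rw [Finset.sum_smul, map_sum, Finset.sum_mul]
      exact Finset.sum_congr rfl fun l _ => hhom l }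

theorem gradedComponent_apply (x : FrobeniusPushforward (monomialSubring k S) p e) :
    gradedComponent φ j x = ∑ᶠ i, gradedPart φ j i x := rfl

theorem exists_isUnit_of_notMem_irrelevantIdeal
    (h : FrobeniusPushforward (monomialSubring k S) p e) (hh : h ∈ homogeneousElements k p e S)
    (hφ : φ h ∉ irrelevantIdeal k S) :
    ∃ ψ : FrobeniusPushforward (monomialSubring k S) p e →ₗ[monomialSubring k S]
      monomialSubring k S, IsUnit (ψ h) := by
  obtain ⟨j, hj⟩ := mem_homogeneousElements.mp hh
  refine ⟨gradedComponent φ j, ?_⟩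
  have hq : 0 < p ^ e := pow_pos (expChar_pos k p) e
  have hcomp : ∀ i, pushComponent (j + i * p ^ e) h = if i = 0 then h else 0 := by
    intro i
    apply polynomial_injective
    rw [polynomial_pushComponent, MvPolynomial.homogeneousComponent_of_mem
      ((MvPolynomial.mem_homogeneousSubmodule _ _).mpr hj)]
    by_cases hi : i = 0
    · simp [hi]
    · rw [if_neg hi, if_neg (by have := Nat.mul_pos (Nat.pos_of_ne_zero hi) hq; omega), map_zero]
  have : gradedComponent φ j h =
      algebraMap k _ ((φ h : MvPolynomial (Fin n) k).coeff 0) := by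
    rw [gradedComponent_apply, finsum_eq_single _ 0]
    · rw [gradedPart_apply, hcomp, if_pos rfl]
      exact Subtype.ext (MvPolynomial.homogeneousComponent_zero _)
    · intro i hi
      rw [gradedPart_apply, hcomp, if_neg hi, map_zero, map_zero]
  rw [this]
  exact (IsUnit.mk0 _ hφ).map _

end PushforwardValue

/-! ### Exponent vectors modulo q times the lattice. -/

section FrobeniusClasses

variable {n : ℕ} (S : AddSubmonoid (Fin n →₀ ℕ)) (q : ℕ)

/-- An exponent vector, regarded as an integer vector. -/
noncomputable def intVec {n : ℕ} : (Fin n →₀ ℕ) →+ (Fin n → ℤ) where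
  toFun s i := s i
  map_zero' := by ext; simp
  map_add' s t := by ext; simp

theorem intVec_apply (s : Fin n →₀ ℕ) (i : Fin n) : intVec s i = s i := rfl

theorem intVec_injective : Function.Injective (intVec (n := n)) := by
  intro s t h
  ext i
  exact Nat.cast_injective (R := ℤ) (congrFun h i)

variable {S q} in
theorem intVec_mem_lattice {s : Fin n →₀ ℕ} (hs : s ∈ S) : intVec s ∈ lattice S :=
  AddSubgroup.subset_closure ⟨s, hs, rfl⟩

variable {S q} in
theorem IsFull.mem_iff (h : IsFull S) {s : Fin n →₀ ℕ} : intVec s ∈ lattice S ↔ s ∈ S := h s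

variable {S q} in
theorem IsFull.exists_intVec_eq (h : IsFull S) {v : Fin n → ℤ} (hv : v ∈ lattice S)
    (h0 : ∀ i, 0 ≤ v i) : ∃ s ∈ S, intVec s = v := by
  have : intVec (Finsupp.equivFunOnFinite.symm fun i => (v i).toNat) = v := by
    ext i
    rw [intVec_apply]
    simp [h0 i]
  exact ⟨_, h.mem_iff.mp (this.symm ▸ hv), this⟩

theorem exists_sub_of_mem_lattice {v : Fin n → ℤ} (hv : v ∈ lattice S) :
    ∃ a ∈ S, ∃ b ∈ S, v = intVec a - intVec b := by
  induction hv using AddSubgroup.closure_induction with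
  | mem x hx =>
    obtain ⟨s, hs, rfl⟩ := hx
    exact ⟨s, hs, 0, S.zero_mem, by rw [map_zero, sub_zero]; rfl⟩
  | zero => exact ⟨0, S.zero_mem, 0, S.zero_mem, by simp⟩
  | add x y _ _ hx hy =>
    obtain ⟨a, ha, b, hb, rfl⟩ := hx
    obtain ⟨c, hc, d, hd, rfl⟩ := hy
    exact ⟨a + c, S.add_mem ha hc, b + d, S.add_mem hb hd, by rw [map_add, map_add]; abel⟩
  | neg x _ hx =>
    obtain ⟨a, ha, b, hb, rfl⟩ := hx
    exact ⟨b, hb, a, ha, by abel⟩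

/-- The class of an exponent vector modulo `q` times the lattice of `S`. -/
noncomputable def latticeClass (s : Fin n →₀ ℕ) :
    (Fin n → ℤ) ⧸ (lattice S).map (zsmulAddGroupHom (q : ℤ)) :=
  QuotientAddGroup.mk' _ (intVec s)

variable {S q}

theorem latticeClass_eq_iff {s t : Fin n →₀ ℕ} :
    latticeClass S q s = latticeClass S q t ↔
      ∃ w ∈ lattice S, intVec t = intVec s + (q : ℤ) • w := by
  rw [latticeClass, latticeClass, QuotientAddGroup.mk'_apply, QuotientAddGroup.mk'_apply,
    QuotientAddGroup.eq, AddSubgroup.mem_map]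
  refine exists_congr fun w => and_congr_right fun _ => ?_
  rw [zsmulAddGroupHom_apply, eq_neg_add_iff_add_eq, eq_comm]

theorem latticeClass_smul_add {u : Fin n →₀ ℕ} (hu : u ∈ S) (s : Fin n →₀ ℕ) :
    latticeClass S q (q • u + s) = latticeClass S q s := by
  rw [eq_comm, latticeClass_eq_iff]
  refine ⟨intVec u, intVec_mem_lattice hu, ?_⟩
  rw [map_add, map_nsmul, add_comm, natCast_zsmul]

theorem exists_add_smul_eq_of_latticeClass_eq {s t : Fin n →₀ ℕ}
    (h : latticeClass S q s = latticeClass S q t) :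
    ∃ u ∈ S, ∃ v ∈ S, q • u + s = q • v + t := by
  obtain ⟨w, hw, hst⟩ := latticeClass_eq_iff.mp h
  obtain ⟨a, ha, b, hb, rfl⟩ := exists_sub_of_mem_lattice S hw
  refine ⟨a, ha, b, hb, intVec_injective ?_⟩
  rw [map_add, map_add, hst, map_nsmul, map_nsmul, smul_sub, natCast_zsmul, natCast_zsmul]
  abel

/-- The quotient of ℤⁿ by qL is infinite when L has smaller rank; only the image of L matters, and
it is finitely generated and killed by q. -/
theorem finite_latticeClass (hq : 0 < q) : {g | ∃ s ∈ S, latticeClass S q s = g}.Finite := by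
  let f : lattice S →+ (Fin n → ℤ) ⧸ (lattice S).map (zsmulAddGroupHom (q : ℤ)) :=
    (QuotientAddGroup.mk' _).comp (lattice S).subtype
  have : Module.Finite ℤ (lattice S) :=
    inferInstanceAs (Module.Finite ℤ (lattice S).toIntSubmodule)
  have hfin : Finite (LinearMap.range f.toIntLinearMap) := by
    apply Module.finite_of_fg_torsion
    rintro ⟨_, x, rfl⟩
    refine ⟨⟨(q : ℤ), mem_nonZeroDivisors_of_ne_zero (by exact_mod_cast hq.ne')⟩, ?_⟩
    apply Subtype.ext
    change (q : ℤ) • f x = 0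
    rw [← map_zsmul]
    exact (QuotientAddGroup.eq_zero_iff _).mpr ⟨x, x.2, rfl⟩
  refine Set.Finite.subset (Set.toFinite (LinearMap.range f.toIntLinearMap : Set _)) ?_
  rintro _ ⟨s, hs, rfl⟩
  exact ⟨⟨intVec s, intVec_mem_lattice hs⟩, rfl⟩

/-- The exponent vectors of the monomials of `S` all of whose exponents are less than `q`. -/
noncomputable def box (S : AddSubmonoid (Fin n →₀ ℕ)) (q : ℕ) : Set (Fin n →₀ ℕ) :=
  {s | s ∈ S ∧ ∀ i, s i < q}

theorem exists_eq_smul_add_of_mem_box (hS : IsFull S) {s t : Fin n →₀ ℕ} (hs : s ∈ box S q)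
    (h : latticeClass S q s = latticeClass S q t) : ∃ u ∈ S, t = q • u + s := by
  obtain ⟨w, hw, hst⟩ := latticeClass_eq_iff.mp h
  obtain ⟨u, hu, rfl⟩ := hS.exists_intVec_eq hw fun i => by
    have h1 := congrFun hst i
    have h2 := hs.2 i
    simp only [intVec_apply, Pi.add_apply, Pi.smul_apply, smul_eq_mul] at h1
    by_contra hneg
    -- If w i ≤ -1, then s i < q makes the exponent t i negative.
    have : (q : ℤ) * w i ≤ q * (-1) := by
      apply mul_le_mul_of_nonneg_left <;> omega
    omega
  refine ⟨u, hu, intVec_injective ?_⟩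
  rw [hst, map_add, map_nsmul, natCast_zsmul, add_comm]

theorem eq_of_mem_box_of_latticeClass_eq (hS : IsFull S) {s t : Fin n →₀ ℕ} (hs : s ∈ box S q)
    (ht : t ∈ box S q) (h : latticeClass S q s = latticeClass S q t) : s = t := by
  obtain ⟨u, -, rfl⟩ := exists_eq_smul_add_of_mem_box hS hs h
  ext i
  have h1 := ht.2 i
  simp only [Finsupp.add_apply, Finsupp.smul_apply, smul_eq_mul] at h1 ⊢
  rcases Nat.eq_zero_or_pos (u i) with h0 | h0
  · simp [h0]
  · nlinarith

/-- The vector ζ - η of property (*) has i-th coordinate -1 and all others nonnegative. Adding q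
times it to s keeps s nonnegative, because s i ≥ q, so fullness keeps it in S. -/
theorem exists_lt_of_le (hS : IsFull S) (hstar : PropertyStar S) (hq : 0 < q) {s : Fin n →₀ ℕ}
    (hs : s ∈ S) {i : Fin n} (hi : q ≤ s i) :
    ∃ t ∈ S, latticeClass S q s = latticeClass S q t ∧ t i < s i := by
  obtain ⟨ζ, hζ, η, hη, τ, hτ, h⟩ := hstar i
  have hw : intVec ζ - intVec η ∈ lattice S :=
    sub_mem (intVec_mem_lattice hζ) (intVec_mem_lattice hη)
  have hwj : ∀ j, (intVec ζ - intVec η) j = τ j - if i = j then 1 else 0 := by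
    intro j
    have := DFunLike.congr_fun h j
    simp only [Finsupp.add_apply, Finsupp.single_apply] at this
    rw [Pi.sub_apply, intVec_apply, intVec_apply]
    split_ifs at this ⊢ <;> omega
  obtain ⟨t, ht, htv⟩ := hS.exists_intVec_eq (v := intVec s + (q : ℤ) • (intVec ζ - intVec η))
    (add_mem (intVec_mem_lattice hs) (zsmul_mem hw _)) fun j => by
      rw [Pi.add_apply, Pi.smul_apply, hwj, intVec_apply, smul_eq_mul]
      split_ifs with hij
      · subst hij
        rw [hτ]
        push_cast
        omega
      · rw [sub_zero]
        positivity
  refine ⟨t, ht, latticeClass_eq_iff.mpr ⟨_, hw, htv⟩, ?_⟩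
  have := congrFun htv i
  rw [Pi.add_apply, Pi.smul_apply, hwj, intVec_apply, intVec_apply, smul_eq_mul, if_pos rfl,
    hτ] at this
  push_cast at this
  omega

end FrobeniusClasses

/-! ### Rank-one torsion-free modules are indecomposable. -/

section Generic

variable {R : Type*} [CommRing R] {M : Type*} [AddCommGroup M] [Module R M]

theorem eq_smul_symm_one {N : Submodule R M} (ε : N ≃ₗ[R] R) (x : N) :
    (x : M) = ε x • (ε.symm 1 : M) := by
  rw [← Submodule.coe_smul, ← map_smul, smul_eq_mul, mul_one, LinearEquiv.symm_apply_apply]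

variable [IsDomain R]

/-- The elements some nonzero multiple of which is a multiple of `v`. -/
def commensurableSubmodule (R : Type*) [CommRing R] [IsDomain R] {M : Type*} [AddCommGroup M]
    [Module R M] (v : M) : Submodule R M where
  carrier := {x | ∃ r r' : R, r ≠ 0 ∧ r • x = r' • v}
  zero_mem' := ⟨1, 0, one_ne_zero, by rw [smul_zero, zero_smul]⟩
  add_mem' := by
    rintro x y ⟨r, r', hr, hx⟩ ⟨t, t', ht, hy⟩
    refine ⟨r * t, t * r' + r * t', mul_ne_zero hr ht, ?_⟩
    rw [smul_add, add_smul, mul_smul, mul_smul, mul_smul t, mul_smul r t', ← hx, ← hy,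
      smul_comm r t x]
  smul_mem' := by
    rintro c x ⟨r, r', hr, hx⟩
    exact ⟨r, c * r', hr, by rw [smul_comm, hx, mul_smul]⟩

/-- Two nonzero elements commensurable with v have a common nonzero multiple, so two nonzero
submodules of N always meet. -/
theorem isIndecomposable_of_le_commensurableSubmodule
    (htf : ∀ (r : R) (x : M), r • x = 0 → r = 0 ∨ x = 0) {N : Submodule R M} (hN : N ≠ ⊥) {v : M}
    (hv : N ≤ commensurableSubmodule R v) : IsIndecomposable R N := by
  refine ⟨hN, fun A B hAB hdisj => ?_⟩
  by_contra! hne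
  obtain ⟨x, hxA, hx⟩ := Submodule.exists_mem_ne_zero_of_ne_bot hne.1
  obtain ⟨y, hyB, hy⟩ := Submodule.exists_mem_ne_zero_of_ne_bot hne.2
  obtain ⟨r, r', hr, hrx⟩ := hv (hAB ▸ le_sup_left (b := B) hxA)
  obtain ⟨t, t', ht, hty⟩ := hv (hAB ▸ le_sup_right (a := A) hyB)
  have hmem : (t' * r) • x ∈ B := by
    rw [mul_smul, hrx, smul_comm, ← hty]
    exact B.smul_mem _ (B.smul_mem _ hyB)
  have hz := Submodule.disjoint_def.mp hdisj _ (A.smul_mem _ hxA) hmem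
  rcases htf _ _ hz with h | h
  · rcases mul_eq_zero.mp h with h | h
    · rw [h, zero_smul] at hty
      exact (htf _ _ hty).elim ht hy
    · exact hr h
  · exact hx h

end Generic

/-! ### The decomposition of F^e_*R by lattice classes. -/

section ClassSubmodules

variable {k : Type*} [Field k] {n : ℕ} {S : AddSubmonoid (Fin n →₀ ℕ)} {p e : ℕ}

theorem polynomial_eq_zero {x : FrobeniusPushforward (monomialSubring k S) p e} :
    polynomial x = 0 ↔ x = 0 :=
  map_eq_zero_iff _ polynomial_injective

/-- The monomial `c x^s`, as an element of `F^e_* k[S]`. -/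
noncomputable def pushMonomial (p e : ℕ) {s : Fin n →₀ ℕ} (hs : s ∈ S) (c : k) :
    FrobeniusPushforward (monomialSubring k S) p e :=
  (⟨MvPolynomial.monomial s c, monomial_mem_monomialSubring hs c⟩ : monomialSubring k S)

theorem polynomial_pushMonomial {s : Fin n →₀ ℕ} (hs : s ∈ S) (c : k) :
    polynomial (pushMonomial p e hs c) = MvPolynomial.monomial s c := rfl

theorem pushMonomial_mem_homogeneousElements {s : Fin n →₀ ℕ} (hs : s ∈ S) (c : k) :
    pushMonomial p e hs c ∈ homogeneousElements k p e S :=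
  ⟨s.degree, MvPolynomial.isHomogeneous_monomial c rfl⟩

theorem pushMonomial_ne_zero {s : Fin n →₀ ℕ} (hs : s ∈ S) {c : k} (hc : c ≠ 0) :
    pushMonomial p e hs c ≠ 0 := by
  rw [Ne, ← polynomial_eq_zero, polynomial_pushMonomial, MvPolynomial.monomial_eq_zero]
  exact hc

variable [ExpChar k p]

/-- Raising to the power p^e is additive, so it only raises each term of f to that power. -/
theorem exists_eq_smul_of_mem_support_pow {f : MvPolynomial (Fin n) k} {s : Fin n →₀ ℕ}
    (hs : s ∈ (f ^ p ^ e).support) : ∃ u ∈ f.support, s = p ^ e • u := by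
  classical
  rw [← MvPolynomial.map_iterateFrobenius_expand p] at hs
  obtain ⟨u, hu, rfl⟩ := Finset.mem_image.mp
    (MvPolynomial.support_expand_subset f (MvPolynomial.support_map_subset _ _ hs))
  exact ⟨u, hu, rfl⟩

theorem pushforward_smul_eq_zero {r : monomialSubring k S}
    {x : FrobeniusPushforward (monomialSubring k S) p e} (h : r • x = 0) : r = 0 ∨ x = 0 := by
  rw [← polynomial_eq_zero, polynomial_smul, mul_eq_zero] at h
  refine h.imp (fun h => ?_) polynomial_eq_zero.mp
  exact Subtype.ext (eq_zero_of_pow_eq_zero h)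

theorem pushMonomial_mem_submodule
    {P : Submodule (monomialSubring k S) (FrobeniusPushforward (monomialSubring k S) p e)}
    {x : FrobeniusPushforward (monomialSubring k S) p e}
    (h : ∀ s (hs : s ∈ S) (c : k), s ∈ (polynomial x).support → pushMonomial p e hs c ∈ P) :
    x ∈ P := by
  have : x = ∑ s ∈ (polynomial x).support.attach,
      pushMonomial p e (mem_of_mem_support_polynomial s.2) ((polynomial x).coeff s) := by
    apply polynomial_injective
    rw [map_sum]
    simp_rw [polynomial_pushMonomial]
    rw [Finset.sum_attach _ fun s => MvPolynomial.monomial s ((polynomial x).coeff s)]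
    exact (polynomial x).as_sum
  rw [this]
  exact P.sum_mem fun s _ => h s _ _ s.2

theorem monomial_smul_pushMonomial {u s t : Fin n →₀ ℕ} (hu : u ∈ S) (hs : s ∈ S) (ht : t ∈ S)
    (h : t = p ^ e • u + s) (b c : k) :
    (⟨MvPolynomial.monomial u b, monomial_mem_monomialSubring hu b⟩ : monomialSubring k S) •
      pushMonomial p e hs c = pushMonomial p e ht (b ^ p ^ e * c) := by
  apply polynomial_injective
  rw [polynomial_smul, polynomial_pushMonomial, polynomial_pushMonomial,
    MvPolynomial.monomial_pow, MvPolynomial.monomial_mul, h]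

/-- The submodule of `F^e_* k[S]` spanned by the monomials of class `g`. -/
noncomputable def classSubmodule (k : Type*) [Field k] (S : AddSubmonoid (Fin n →₀ ℕ)) (p e : ℕ) [ExpChar k p]
    (g : (Fin n → ℤ) ⧸ (lattice S).map (zsmulAddGroupHom ((p ^ e : ℕ) : ℤ))) :
    Submodule (monomialSubring k S) (FrobeniusPushforward (monomialSubring k S) p e) where
  carrier := {x | ∀ s ∈ (polynomial x).support, latticeClass S (p ^ e) s = g}
  zero_mem' := by simp
  add_mem' {x y} hx hy s hs := by
    classical
    rw [map_add] at hs
    exact (Finset.mem_union.mp (MvPolynomial.support_add hs)).elim (hx s) (hy s)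
  smul_mem' r x hx s hs := by
    classical
    rw [polynomial_smul] at hs
    obtain ⟨u, hu, v, hv, rfl⟩ := Finset.mem_add.mp (MvPolynomial.support_mul _ _ hs)
    obtain ⟨w, hw, rfl⟩ := exists_eq_smul_of_mem_support_pow hu
    rw [latticeClass_smul_add (mem_monomialSubring_iff.mp r.2 w hw)]
    exact hx v hv

theorem mem_classSubmodule {g} {x : FrobeniusPushforward (monomialSubring k S) p e} :
    x ∈ classSubmodule k S p e g ↔
      ∀ s ∈ (polynomial x).support, latticeClass S (p ^ e) s = g := Iff.rfl

theorem pushMonomial_mem_classSubmodule {s : Fin n →₀ ℕ} (hs : s ∈ S) (c : k) :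
    pushMonomial p e hs c ∈ classSubmodule k S p e (latticeClass S (p ^ e) s) := by
  intro t ht
  rw [polynomial_pushMonomial] at ht
  rw [Finset.mem_singleton.mp (MvPolynomial.support_monomial_subset ht)]

theorem span_homogeneousElements_inter_classSubmodule (g) :
    Submodule.span (monomialSubring k S)
      (homogeneousElements k p e S ∩ (classSubmodule k S p e g : Set _)) =
      classSubmodule k S p e g := by
  refine le_antisymm (Submodule.span_le.mpr Set.inter_subset_right) fun x hx => ?_
  refine pushMonomial_mem_submodule fun s hs c hsx => Submodule.subset_span ⟨?_, ?_⟩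
  · exact pushMonomial_mem_homogeneousElements hs c
  · rw [← mem_classSubmodule.mp hx s hsx]
    exact pushMonomial_mem_classSubmodule hs c

section Perfect

variable [PerfectRing k p]

theorem exists_pow_eq (p e : ℕ) [ExpChar k p] [PerfectRing k p] (c : k) :
    ∃ b : k, b ^ p ^ e = c := by
  obtain ⟨b, hb⟩ := (iterateFrobeniusEquiv k p e).surjective c
  exact ⟨b, by rw [← hb, iterateFrobeniusEquiv_apply, iterateFrobenius_def]⟩

theorem classSubmodule_le_commensurableSubmodule {s : Fin n →₀ ℕ} (hs : s ∈ S) :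
    classSubmodule k S p e (latticeClass S (p ^ e) s) ≤
      commensurableSubmodule (monomialSubring k S) (pushMonomial p e hs (1 : k)) := by
  intro x hx
  refine pushMonomial_mem_submodule fun t ht c htx => ?_
  obtain ⟨u, hu, v, hv, huv⟩ := exists_add_smul_eq_of_latticeClass_eq (mem_classSubmodule.mp hx t htx)
  -- Scalars act through their p^e-th powers, so a coefficient is absorbed only by way of its p^e-th
  -- root.
  obtain ⟨b, rfl⟩ := exists_pow_eq p e c
  refine ⟨⟨MvPolynomial.monomial u 1, monomial_mem_monomialSubring hu 1⟩,
    ⟨MvPolynomial.monomial v b, monomial_mem_monomialSubring hv b⟩, ?_, ?_⟩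
  · intro h
    exact one_ne_zero (MvPolynomial.monomial_eq_zero.mp (congrArg Subtype.val h))
  · rw [monomial_smul_pushMonomial hu ht (S.add_mem (S.nsmul_mem hu _) ht) rfl,
      monomial_smul_pushMonomial hv hs (S.add_mem (S.nsmul_mem hu _) ht) huv]
    simp

theorem isIndecomposable_classSubmodule {s : Fin n →₀ ℕ} (hs : s ∈ S) :
    IsIndecomposable (monomialSubring k S)
      (classSubmodule k S p e (latticeClass S (p ^ e) s)) := by
  refine isIndecomposable_of_le_commensurableSubmodule (fun _ _ => pushforward_smul_eq_zero)
    (fun h => ?_) (classSubmodule_le_commensurableSubmodule hs)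
  have := pushMonomial_mem_classSubmodule (p := p) (e := e) hs (1 : k)
  rw [h, Submodule.mem_bot] at this
  exact pushMonomial_ne_zero hs one_ne_zero this

theorem nonempty_equiv_of_mem_box (hS : IsFull S) {s : Fin n →₀ ℕ} (hs : s ∈ box S (p ^ e)) :
    Nonempty (classSubmodule k S p e (latticeClass S (p ^ e) s) ≃ₗ[monomialSubring k S]
      monomialSubring k S) := by
  let f := LinearMap.toSpanSingleton (monomialSubring k S) _ (pushMonomial p e hs.1 (1 : k))
  have hf : Function.Injective f := by
    rw [injective_iff_map_eq_zero]
    intro r hr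
    exact (pushforward_smul_eq_zero hr).resolve_right (pushMonomial_ne_zero hs.1 one_ne_zero)
  have hrange : LinearMap.range f = classSubmodule k S p e (latticeClass S (p ^ e) s) := by
    apply le_antisymm
    · rintro _ ⟨r, rfl⟩
      exact Submodule.smul_mem _ _ (pushMonomial_mem_classSubmodule hs.1 1)
    · intro x hx
      refine pushMonomial_mem_submodule fun t ht c htx => ?_
      obtain ⟨u, hu, hut⟩ :=
        exists_eq_smul_add_of_mem_box hS hs (mem_classSubmodule.mp hx t htx).symm
      obtain ⟨b, rfl⟩ := exists_pow_eq p e c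
      refine ⟨⟨MvPolynomial.monomial u b, monomial_mem_monomialSubring hu b⟩, ?_⟩
      refine (monomial_smul_pushMonomial hu hs.1 ht hut b 1).trans ?_
      rw [mul_one]
  exact ⟨((LinearEquiv.ofInjective f hf).trans (LinearEquiv.ofEq _ _ hrange)).symm⟩

end Perfect

theorem exists_mem_box_of_equiv (hS : IsFull S) (hstar : PropertyStar S) {s : Fin n →₀ ℕ}
    (hs : s ∈ S) (ε : classSubmodule k S p e (latticeClass S (p ^ e) s) ≃ₗ[monomialSubring k S]
      monomialSubring k S) :
    ∃ t ∈ box S (p ^ e), latticeClass S (p ^ e) t = latticeClass S (p ^ e) s := by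
  have hq : 0 < p ^ e := pow_pos (expChar_pos k p) e
  -- The generator x of the free summand divides, in the polynomial ring, every monomial of its
  -- class; hence it is a monomial.
  set x : FrobeniusPushforward (monomialSubring k S) p e := Subtype.val (ε.symm 1)
  have hdvd : ∀ t ∈ S, latticeClass S (p ^ e) t = latticeClass S (p ^ e) s →
      polynomial x ∣ MvPolynomial.monomial t 1 := by
    intro t ht hts
    have hmem := hts ▸ pushMonomial_mem_classSubmodule (p := p) (e := e) ht (1 : k)
    have : pushMonomial p e ht (1 : k) = ε ⟨_, hmem⟩ • x :=
      eq_smul_symm_one ε ⟨_, hmem⟩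
    rw [← polynomial_pushMonomial (p := p) (e := e) ht, this, polynomial_smul]
    exact dvd_mul_left _ _
  obtain ⟨t, b, -, -, ht⟩ := (MvPolynomial.dvd_monomial_iff_exists one_ne_zero).mp (hdvd s hs rfl)
  have hb : b ≠ 0 := by
    rintro rfl
    have h0 : polynomial x ∣ MvPolynomial.monomial s 1 := hdvd s hs rfl
    rw [ht, MvPolynomial.monomial_zero, zero_dvd_iff, MvPolynomial.monomial_eq_zero] at h0
    exact one_ne_zero h0
  have htsupp : t ∈ (polynomial x).support := by
    rw [ht, MvPolynomial.mem_support_iff, MvPolynomial.coeff_monomial, if_pos rfl]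
    exact hb
  have htS : t ∈ S := mem_of_mem_support_polynomial htsupp
  have hcl : latticeClass S (p ^ e) t = latticeClass S (p ^ e) s :=
    mem_classSubmodule.mp (ε.symm 1).2 t htsupp
  refine ⟨t, ⟨htS, fun i => ?_⟩, hcl⟩
  by_contra! hi
  -- Property (*) gives a monomial of the same class with smaller i-th exponent, which x cannot
  -- divide.
  obtain ⟨t', ht', hcl', hlt⟩ := exists_lt_of_le hS hstar hq htS hi
  have h1 := hdvd t' ht' (hcl'.symm.trans hcl)
  rw [ht, MvPolynomial.monomial_dvd_monomial] at h1
  rcases h1.1 with h | h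
  · exact one_ne_zero h
  · exact absurd (h i) (by omega)

theorem iSupIndep_classSubmodule : iSupIndep (classSubmodule k S p e) := by
  rw [iSupIndep_def]
  intro g
  -- P collects the elements without terms of class g; it contains all the other class submodules.
  let P : Submodule (monomialSubring k S) (FrobeniusPushforward (monomialSubring k S) p e) :=
    { carrier := {x | ∀ s ∈ (polynomial x).support, latticeClass S (p ^ e) s ≠ g}
      zero_mem' := by simp
      add_mem' := by
        classical
        intro x y hx hy s hs
        rw [map_add] at hs
        exact (Finset.mem_union.mp (MvPolynomial.support_add hs)).elim (hx s) (hy s)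
      smul_mem' := by
        classical
        intro r x hx s hs
        rw [polynomial_smul] at hs
        obtain ⟨u, hu, v, hv, rfl⟩ := Finset.mem_add.mp (MvPolynomial.support_mul _ _ hs)
        obtain ⟨w, hw, rfl⟩ := exists_eq_smul_of_mem_support_pow hu
        rw [latticeClass_smul_add (mem_monomialSubring_iff.mp r.2 w hw)]
        exact hx v hv }
  have hle : ⨆ j, ⨆ (_ : j ≠ g), classSubmodule k S p e j ≤ P :=
    iSup₂_le fun j hj x hx s hs => (mem_classSubmodule.mp hx s hs).trans_ne hj
  refine Disjoint.mono_right hle ?_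
  rw [Submodule.disjoint_def]
  intro x hx hxP
  rw [← polynomial_eq_zero, ← MvPolynomial.support_eq_empty, Finset.eq_empty_iff_forall_notMem]
  exact fun s hs => hxP s hs (mem_classSubmodule.mp hx s hs)

theorem isFreeRank_ncard_box [PerfectRing k p] (hS : IsFull S) (hstar : PropertyStar S) :
    IsFreeRank (monomialSubring k S) (homogeneousElements k p e S) (box S (p ^ e)).ncard := by
  have hq : 0 < p ^ e := pow_pos (expChar_pos k p) e
  have hfin := (finite_latticeClass (S := S) hq).to_subtype
  let ι := {g // ∃ s ∈ S, latticeClass S (p ^ e) s = g}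
  have : Finite ι := hfin
  let E : Fin (Nat.card ι) ≃ ι := (Finite.equivFin ι).symm
  refine ⟨Nat.card ι, fun i => classSubmodule k S p e (E i).1, ?_, fun i => ?_, fun i => ?_, ?_⟩
  · apply DirectSum.isInternal_submodule_of_iSupIndep_of_iSup_eq_top
    · exact iSupIndep_classSubmodule.comp (Subtype.val_injective.comp E.injective)
    · rw [eq_top_iff]
      intro x _
      refine pushMonomial_mem_submodule fun s hs c _ => ?_
      refine Submodule.mem_iSup_of_mem (E.symm ⟨_, s, hs, rfl⟩) ?_
      rw [E.apply_symm_apply]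
      exact pushMonomial_mem_classSubmodule hs c
  · exact span_homogeneousElements_inter_classSubmodule _
  · obtain ⟨s, hs, h⟩ := (E i).2
    have := isIndecomposable_classSubmodule (k := k) (p := p) (e := e) hs
    rwa [h] at this
  · let F : box S (p ^ e) → {i // Nonempty (classSubmodule k S p e (E i).1 ≃ₗ[monomialSubring k S]
        monomialSubring k S)} := fun s =>
      ⟨E.symm ⟨_, s, s.2.1, rfl⟩, by
        rw [E.apply_symm_apply]
        exact nonempty_equiv_of_mem_box hS s.2⟩
    have hF : Function.Bijective F := by
      constructor
      · intro s t hst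
        have h := E.symm.injective (congrArg Subtype.val hst)
        exact Subtype.ext (eq_of_mem_box_of_latticeClass_eq hS s.2 t.2 (congrArg Subtype.val h))
      · rintro ⟨i, ⟨ε⟩⟩
        obtain ⟨s, hs, h⟩ := (E i).2
        obtain ⟨t, ht, hts⟩ := exists_mem_box_of_equiv (p := p) (e := e) (k := k) hS hstar hs
          (h ▸ ε)
        refine ⟨⟨t, ht⟩, Subtype.ext ?_⟩
        rw [Equiv.symm_apply_eq]
        exact Subtype.ext (hts.trans h)
    exact Nat.card_congr (Equiv.ofBijective F hF)

theorem frobeniusFreeRank_eq_ncard_box [PerfectRing k p] (hS : IsFull S) (hstar : PropertyStar S) :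
    (∃! a : ℕ, IsFreeRank (monomialSubring k S) (homogeneousElements k p e S) a) ∧
      frobeniusFreeRank k p S e = (box S (p ^ e)).ncard :=
  (isFreeRank_ncard_box hS hstar).freeRank_eq (m := irrelevantIdeal k S)
    exists_isUnit_of_notMem_irrelevantIdeal

end ClassSubmodules

/-! ### The length of R / (m_A^[q] ∩ R). -/

section BracketLength

variable {k : Type*} [Field k] {n : ℕ} {S : AddSubmonoid (Fin n →₀ ℕ)}

/-- A set of exponent vectors is closed under taking divisors in `S`. -/
def IsDivisorClosed (S : AddSubmonoid (Fin n →₀ ℕ)) (B : Set (Fin n →₀ ℕ)) : Prop :=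
  ∀ u ∈ S, ∀ v ∈ S, u + v ∈ B → v ∈ B

/-- The ideal of the elements of `k[S]` without terms in a divisor-closed set of monomials. -/
noncomputable def vanishingIdeal (k : Type*) [Field k] {B : Set (Fin n →₀ ℕ)} (hB : IsDivisorClosed S B) :
    Ideal (monomialSubring k S) where
  carrier := {f | ∀ s ∈ B, (f : MvPolynomial (Fin n) k).coeff s = 0}
  zero_mem' _ _ := MvPolynomial.coeff_zero _
  add_mem' {f g} hf hg s hs := by
    change MvPolynomial.coeff s (f.1 + g.1) = 0
    rw [MvPolynomial.coeff_add, hf s hs, hg s hs, add_zero]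
  smul_mem' r f hf s hs := by
    classical
    change MvPolynomial.coeff s (r.1 * f.1) = 0
    rw [MvPolynomial.coeff_mul]
    refine Finset.sum_eq_zero fun ⟨u, v⟩ huv => ?_
    rw [Finset.HasAntidiagonal.mem_antidiagonal] at huv
    by_cases hu : u ∈ S
    · by_cases hv : v ∈ S
      · rw [hf v (hB u hu v hv (huv ▸ hs)), mul_zero]
      · rw [coeff_eq_zero_of_notMem f hv, mul_zero]
    · rw [coeff_eq_zero_of_notMem r hu, zero_mul]

theorem mem_vanishingIdeal {B : Set (Fin n →₀ ℕ)} {hB : IsDivisorClosed S B}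
    {f : monomialSubring k S} :
    f ∈ vanishingIdeal k hB ↔ ∀ s ∈ B, (f : MvPolynomial (Fin n) k).coeff s = 0 := Iff.rfl

theorem IsDivisorClosed.erase {B : Finset (Fin n →₀ ℕ)} (hB : IsDivisorClosed S (B : Set _))
    {s : Fin n →₀ ℕ} (hmax : ∀ t ∈ B, t.degree ≤ s.degree) :
    IsDivisorClosed S (B.erase s : Set _) := by
  intro u hu v hv huv
  simp only [Finset.coe_erase, Set.mem_sdiff, Finset.mem_coe, Set.mem_singleton_iff] at huv ⊢
  refine ⟨hB u hu v hv huv.1, ?_⟩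
  rintro rfl
  have h1 := hmax _ huv.1
  rw [map_add] at h1
  have h2 : u = 0 := (Finsupp.degree_eq_zero_iff u).mp (by omega)
  exact huv.2 (by rw [h2, zero_add])

theorem coeff_mul_monomial_of_degree_le (f : MvPolynomial (Fin n) k) {s t : Fin n →₀ ℕ}
    (ht : t.degree ≤ s.degree) (c : k) :
    (f * MvPolynomial.monomial s c).coeff t = if t = s then f.coeff 0 * c else 0 := by
  rw [MvPolynomial.coeff_mul_monomial']
  by_cases hst : s ≤ t
  · obtain ⟨u, rfl⟩ := exists_add_of_le hst
    rw [map_add] at ht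
    have hu : u = 0 := (Finsupp.degree_eq_zero_iff u).mp (by omega)
    subst hu
    simp
  · rw [if_neg hst, if_neg fun h => hst h.ge]

/-- Length is additive on 0 → R/m → R/J → R/I → 0, the first map being multiplication by x. -/
theorem quotientLength_eq_one_add {R : Type*} [CommRing R] {m J I : Ideal R} [m.IsMaximal]
    (hJI : J ≤ I) {x : R} (hxI : x ∈ I) (hxJ : ∀ r, r * x ∈ J ↔ r ∈ m)
    (hI : ∀ r ∈ I, ∃ c, c * x - r ∈ J) : quotientLength J = 1 + quotientLength I := by
  let f := Submodule.mapQ m J (LinearMap.toSpanSingleton R R x) fun r hr => (hxJ r).mpr hr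
  let g := Submodule.mapQ J I LinearMap.id hJI
  have hf : Function.Injective f := by
    rw [injective_iff_map_eq_zero]
    intro r hr
    obtain ⟨r, rfl⟩ := Submodule.Quotient.mk_surjective _ r
    exact (Submodule.Quotient.mk_eq_zero _).mpr
      ((hxJ r).mp ((Submodule.Quotient.mk_eq_zero _).mp hr))
  have hg : Function.Surjective g := by
    intro r
    obtain ⟨r, rfl⟩ := Submodule.Quotient.mk_surjective _ r
    exact ⟨Submodule.Quotient.mk r, rfl⟩
  have hfg : Function.Exact f g := by
    intro r
    obtain ⟨r, rfl⟩ := Submodule.Quotient.mk_surjective _ r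
    constructor
    · intro hr
      obtain ⟨c, hc⟩ := hI r ((Submodule.Quotient.mk_eq_zero _).mp hr)
      exact ⟨Submodule.Quotient.mk c, (Submodule.Quotient.eq _).mpr hc⟩
    · rintro ⟨t, ht⟩
      obtain ⟨t, rfl⟩ := Submodule.Quotient.mk_surjective _ t
      rw [← ht]
      exact (Submodule.Quotient.mk_eq_zero _).mpr (I.mul_mem_left t hxI)
  have hsimple : IsSimpleModule R (R ⧸ m) := isSimpleModule_iff_isCoatom.mpr Ideal.IsMaximal.out
  rw [quotientLength, quotientLength, Module.length_eq_add_of_exact f g hf hg hfg,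
    Module.length_eq_one]

theorem quotientLength_top (R : Type*) [CommRing R] : quotientLength (⊤ : Ideal R) = 0 := by
  rw [quotientLength, Module.length_eq_zero_iff]
  exact Ideal.Quotient.subsingleton_iff.mpr rfl

theorem quotientLength_vanishingIdeal (B : Finset (Fin n →₀ ℕ)) (hBS : ∀ s ∈ B, s ∈ S)
    (hB : IsDivisorClosed S (B : Set _)) :
    quotientLength (vanishingIdeal k hB) = B.card := by
  induction hc : B.card generalizing B with
  | zero =>
    rw [Finset.card_eq_zero] at hc
    have : vanishingIdeal k hB = ⊤ := by
      rw [Ideal.eq_top_iff_one, mem_vanishingIdeal]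
      simp [hc]
    rw [Nat.cast_zero, this, quotientLength_top]
  | succ N ih =>
    -- With s of maximal degree, `B.erase s` stays divisor-closed, and a multiple r * x^s has no
    -- term in B except possibly r(0) x^s.
    obtain ⟨s, hs, hmax⟩ := Finset.exists_max_image B Finsupp.degree
      (Finset.card_pos.mp (by omega))
    have hB' := hB.erase hmax
    have hIB : ∀ {f : monomialSubring k S}, f ∈ vanishingIdeal k hB ↔
        f ∈ vanishingIdeal k hB' ∧ (f : MvPolynomial (Fin n) k).coeff s = 0 := by
      intro f
      simp only [mem_vanishingIdeal, Finset.coe_erase, Set.mem_sdiff, Finset.mem_coe,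
        Set.mem_singleton_iff]
      refine ⟨fun h => ⟨fun t ht => h t ht.1, h s hs⟩, fun h t ht => ?_⟩
      by_cases hts : t = s
      · exact hts ▸ h.2
      · exact h.1 t ⟨ht, hts⟩
    let x : monomialSubring k S :=
      ⟨MvPolynomial.monomial s 1, monomial_mem_monomialSubring (hBS s hs) 1⟩
    have hcoeff : ∀ (r : monomialSubring k S), ∀ t ∈ B,
        ((r * x : monomialSubring k S) : MvPolynomial (Fin n) k).coeff t =
          if t = s then (r : MvPolynomial (Fin n) k).coeff 0 else 0 := by
      intro r t ht
      have := coeff_mul_monomial_of_degree_le r.1 (hmax t ht) 1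
      rw [mul_one] at this
      exact this
    have hxB' : ∀ r, r * x ∈ vanishingIdeal k hB' := by
      intro r t ht
      rw [Finset.mem_coe, Finset.mem_erase] at ht
      rw [hcoeff r t ht.2, if_neg ht.1]
    have hxB : ∀ r, r * x ∈ vanishingIdeal k hB ↔ r ∈ irrelevantIdeal k S := by
      intro r
      rw [hIB, hcoeff r s hs, if_pos rfl, mem_irrelevantIdeal]
      exact and_iff_right (hxB' r)
    have hIx : ∀ r ∈ vanishingIdeal k hB', ∃ c, c * x - r ∈ vanishingIdeal k hB := by
      intro r hr
      refine ⟨algebraMap k _ ((r : MvPolynomial (Fin n) k).coeff s), ?_⟩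
      rw [hIB]
      refine ⟨sub_mem (hxB' _) hr, ?_⟩
      have h1 := hcoeff (algebraMap k _ ((r : MvPolynomial (Fin n) k).coeff s)) s hs
      rw [if_pos rfl] at h1
      change MvPolynomial.coeff s (_ - r.1) = 0
      rw [MvPolynomial.coeff_sub, sub_eq_zero]
      exact h1.trans (MvPolynomial.coeff_zero_C _)
    rw [quotientLength_eq_one_add (fun r hr => (hIB.mp hr).1) (one_mul x ▸ hxB' 1) hxB hIx,
      ih (B.erase s) (fun t ht => hBS t (Finset.mem_of_mem_erase ht)) hB'
        (by rw [Finset.card_erase_of_mem hs, hc, Nat.add_sub_cancel])]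
    push_cast
    exact add_comm _ _

theorem finite_box (S : AddSubmonoid (Fin n →₀ ℕ)) (q : ℕ) : (box S q).Finite :=
  (Set.finite_Iic (Finsupp.equivFunOnFinite.symm fun _ => q)).subset fun _ hs i => (hs.2 i).le

theorem isDivisorClosed_box (S : AddSubmonoid (Fin n →₀ ℕ)) (q : ℕ) :
    IsDivisorClosed S (box S q) :=
  fun _ _ _ hv huv => ⟨hv, fun i => (Nat.le_add_left _ _).trans_lt (huv.2 i)⟩

/-- By additivity of the p^e-th power, the bracket power is the monomial ideal generated by the
x_i^(p^e). -/
theorem mem_bracketPower_iff {p e : ℕ} [ExpChar k p] {f : MvPolynomial (Fin n) k} :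
    f ∈ bracketPower (homogeneousMaximalIdeal k n) (p ^ e) ↔
      ∀ s ∈ f.support, ∃ i, p ^ e ≤ s i := by
  have h : bracketPower (homogeneousMaximalIdeal k n) (p ^ e) =
      Ideal.span ((fun s => MvPolynomial.monomial s (1 : k)) ''
        Set.range fun i => Finsupp.single i (p ^ e)) := by
    apply le_antisymm
    · rw [bracketPower, Ideal.span_le]
      rintro _ ⟨x, hx, rfl⟩
      rw [SetLike.mem_coe, MvPolynomial.mem_ideal_span_monomial_image]
      intro s hs
      obtain ⟨u, hu, rfl⟩ := exists_eq_smul_of_mem_support_pow hs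
      rw [SetLike.mem_coe, homogeneousMaximalIdeal, ← Set.image_univ,
        MvPolynomial.mem_ideal_span_X_image] at hx
      obtain ⟨i, -, hi⟩ := hx u hu
      refine ⟨_, ⟨i, rfl⟩, ?_⟩
      rw [Finsupp.single_le_iff, Finsupp.smul_apply, smul_eq_mul]
      exact Nat.le_mul_of_pos_right _ (Nat.pos_of_ne_zero hi)
    · rw [Ideal.span_le]
      rintro _ ⟨_, ⟨i, rfl⟩, rfl⟩
      refine Ideal.subset_span ⟨MvPolynomial.X i, Ideal.subset_span ⟨i, rfl⟩, ?_⟩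
      exact MvPolynomial.X_pow_eq_monomial
  rw [h, MvPolynomial.mem_ideal_span_monomial_image]
  simp [Finsupp.single_le_iff]

theorem bracketLength_eq_ncard_box (k : Type*) [Field k] (S : AddSubmonoid (Fin n →₀ ℕ)) (p e : ℕ)
    [ExpChar k p] : bracketLength k S (p ^ e) = (box S (p ^ e)).ncard := by
  have hfin := finite_box S (p ^ e)
  have hB : IsDivisorClosed S (hfin.toFinset : Set _) := by
    rw [hfin.coe_toFinset]
    exact isDivisorClosed_box S _
  have hI : (bracketPower (homogeneousMaximalIdeal k n) (p ^ e)).comap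
      (algebraMap (monomialSubring k S) (MvPolynomial (Fin n) k)) = vanishingIdeal k hB := by
    ext f
    rw [Ideal.mem_comap, mem_bracketPower_iff, mem_vanishingIdeal]
    change (∀ s ∈ (f : MvPolynomial (Fin n) k).support, _) ↔ _
    simp only [hfin.coe_toFinset]
    constructor
    · intro h s hs
      by_contra hne
      obtain ⟨i, hi⟩ := h s (MvPolynomial.mem_support_iff.mpr hne)
      exact absurd (hs.2 i) (by omega)
    · intro h s hs
      by_contra! hlt
      exact MvPolynomial.mem_support_iff.mp hs (h s ⟨mem_monomialSubring_iff.mp f.2 s hs, hlt⟩)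
  rw [bracketLength, hI,
    quotientLength_vanishingIdeal _ (fun s hs => (hfin.mem_toFinset.mp hs).1),
    Set.ncard_eq_toFinset_card _ hfin]

end BracketLength

/-! ### Counting lattice points in dilated cubes. -/

section Asymptotics

open scoped Pointwise

variable {n : ℕ}

theorem exists_basis_lattice (S : AddSubmonoid (Fin n →₀ ℕ)) :
    ∃ (r : ℕ) (v : Fin r → Fin n → ℤ), LinearIndependent ℤ v ∧
      ∀ w, w ∈ lattice S ↔ ∃ z : Fin r → ℤ, ∑ i, z i • v i = w := by
  let L : Submodule ℤ (Fin n → ℤ) := AddSubgroup.toIntSubmodule (lattice S)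
  obtain ⟨r, ⟨b⟩⟩ := Submodule.nonempty_basis_of_pid (Pi.basisFun ℤ (Fin n)) L
  refine ⟨r, fun i => (b i).val, b.linearIndependent.map' L.subtype L.ker_subtype, fun w => ?_⟩
  constructor
  · intro hw
    refine ⟨fun i => b.repr ⟨w, hw⟩ i, ?_⟩
    have := congrArg L.subtype (b.sum_repr ⟨w, hw⟩)
    rw [map_sum] at this
    exact this
  · rintro ⟨z, rfl⟩
    exact sum_mem fun i _ => zsmul_mem (b i).2 _

theorem tendsto_ncard_box_div_pow {S : AddSubmonoid (Fin n →₀ ℕ)} (hS : IsFull S) {r : ℕ}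
    {v : Fin r → Fin n → ℤ} (hv : LinearIndependent ℤ v)
    (hL : ∀ w, w ∈ lattice S ↔ ∃ z : Fin r → ℤ, ∑ i, z i • v i = w) :
    ∃ V : ℝ, Tendsto (fun q : ℕ => ((box S q).ncard : ℝ) / (q : ℝ) ^ r) atTop (𝓝 V) := by
  let vR : Fin r → Fin n → ℝ := fun i => algebraMap ℤ ℝ ∘ v i
  have hvR : LinearIndependent ℝ vR := linearIndependent_algebraMap_comp_iff.mpr hv
  let T : (Fin r → ℝ) →ₗ[ℝ] (Fin n → ℝ) := Fintype.linearCombination ℝ vR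
  have hT : Function.Injective T := linearIndependent_iff_injective_fintypeLinearCombination.mp hvR
  have hTapply : ∀ y j, T y j = ∑ i, y i * v i j := by
    intro y j
    simp [T, vR, Fintype.linearCombination_apply, Finset.sum_apply]
  -- P is the half-open unit cube in coordinates with respect to the lattice basis. It is bounded
  -- because T is injective, and its frontier is null because it is convex; its points in q⁻¹ℤ^r
  -- correspond to the box.
  let P : Set (Fin r → ℝ) := T ⁻¹' Set.univ.pi fun _ => Set.Ico 0 1
  have hPconv : Convex ℝ P :=
    (convex_pi fun _ _ => convex_Ico (0 : ℝ) 1).linear_preimage T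
  have hPmeas : MeasurableSet P :=
    T.continuous_of_finiteDimensional.measurable (MeasurableSet.univ_pi fun _ => measurableSet_Ico)
  have hPbdd : Bornology.IsBounded P := by
    obtain ⟨K, -, hK⟩ := T.exists_antilipschitzWith (LinearMap.ker_eq_bot.mpr hT)
    exact hK.isBounded_preimage (Bornology.IsBounded.pi fun _ => Metric.isBounded_Ico 0 1)
  have key := tendsto_card_div_pow_atTop_volume P hPbdd hPmeas
    (hPconv.addHaar_frontier MeasureTheory.volume)
  rw [Fintype.card_fin] at key
  refine ⟨_, key.congr' ?_⟩
  filter_upwards [eventually_gt_atTop 0] with q hq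
  have : NeZero q := ⟨hq.ne'⟩
  have hq' : (0 : ℝ) < q := by exact_mod_cast hq
  congr 2
  let Z : Set (Fin r → ℤ) := {z | ∀ j, 0 ≤ ∑ i, z i * v i j ∧ ∑ i, z i * v i j < q}
  have hTz : ∀ (z : Fin r → ℤ) j, T (fun i => (z i : ℝ) / q) j =
      ((∑ i, z i * v i j : ℤ) : ℝ) / q := by
    intro z j
    rw [hTapply]
    push_cast
    rw [Finset.sum_div]
    exact Finset.sum_congr rfl fun i _ => by ring
  have hZP : ∀ z : Fin r → ℤ, (fun i => (z i : ℝ) / q) ∈ P ↔ z ∈ Z := by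
    intro z
    change (∀ j, j ∈ Set.univ → _) ↔ _
    simp only [Set.mem_univ, true_imp_iff]
    refine forall_congr' fun j => ?_
    rw [hTz, Set.mem_Ico, div_lt_one hq']
    refine and_congr ?_ ?_
    · rw [le_div_iff₀ hq', zero_mul]
      exact Int.cast_nonneg_iff
    · exact_mod_cast Iff.rfl
  have h1 : P ∩ ((q : ℝ)⁻¹ • Submodule.span ℤ (Set.range (Pi.basisFun ℝ (Fin r))) :
      Submodule ℤ (Fin r → ℝ)) =
      (fun (z : Fin r → ℤ) i => (z i : ℝ) / q) '' Z := by
    ext y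
    rw [Set.mem_inter_iff]
    have hmem : y ∈ (q : ℝ)⁻¹ • Submodule.span ℤ (Set.range (Pi.basisFun ℝ (Fin r))) ↔
      ∀ i, q * y i ∈ Set.range (algebraMap ℤ ℝ) := BoxIntegral.unitPartition.mem_smul_span_iff
    refine (and_congr_right fun _ => hmem).trans ?_
    constructor
    · rintro ⟨hP, hy⟩
      choose z hz using hy
      have hyz : y = fun i => (z i : ℝ) / q := by
        ext i
        rw [eq_div_iff hq'.ne', mul_comm]
        exact (hz i).symm
      exact ⟨z, (hZP z).mp (hyz ▸ hP), hyz.symm⟩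
    · rintro ⟨z, hz, rfl⟩
      exact ⟨(hZP z).mpr hz, fun i => ⟨z i, by simp [mul_div_cancel₀, hq'.ne']⟩⟩
  have h2 : intVec '' box S q = (fun z : Fin r → ℤ => ∑ i, z i • v i) '' Z := by
    have happ : ∀ (z : Fin r → ℤ) j, (∑ i, z i • v i) j = ∑ i, z i * v i j := by
      intro z j
      rw [Finset.sum_apply]
      rfl
    ext w
    constructor
    · rintro ⟨s, ⟨hs, hlt⟩, rfl⟩
      obtain ⟨z, hz⟩ := (hL _).mp (intVec_mem_lattice hs)
      refine ⟨z, fun j => ?_, hz⟩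
      rw [← happ, hz, intVec_apply]
      exact ⟨Int.natCast_nonneg _, by exact_mod_cast hlt j⟩
    · rintro ⟨z, hz, rfl⟩
      obtain ⟨s, hs, hsz⟩ := hS.exists_intVec_eq ((hL _).mpr ⟨z, rfl⟩) fun j => by
        rw [happ]
        exact (hz j).1
      refine ⟨s, ⟨hs, fun j => ?_⟩, hsz⟩
      have := (hz j).2
      rw [← happ, ← hsz, intVec_apply] at this
      exact_mod_cast this
  change (P ∩ ((q : ℝ)⁻¹ • Submodule.span ℤ (Set.range (Pi.basisFun ℝ (Fin r))) :
      Submodule ℤ (Fin r → ℝ))).ncard = _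
  rw [h1, Set.ncard_image_of_injective, ← Set.ncard_image_of_injective (box S q) intVec_injective,
    h2, Set.ncard_image_of_injective Z
      (show Function.Injective fun z : Fin r → ℤ => ∑ i, z i • v i from
        linearIndependent_iff_injective_fintypeLinearCombination.mp hv)]
  intro z z' h
  ext i
  have := congrFun h i
  simp only [div_left_inj' hq'.ne', Int.cast_inj] at this
  exact this

/-- The denominator has an extra factor p^(e(d-r)): it is 1 if r = d and sends the quotient to 0
otherwise. -/
theorem tendsto_div_pow_of_tendsto_div_pow {p r d : ℕ} (hp : 2 ≤ p) (hrd : r ≤ d) {N : ℕ → ℕ}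
    (h : ∃ V : ℝ, Tendsto (fun q : ℕ => (N q : ℝ) / (q : ℝ) ^ r) atTop (𝓝 V)) :
    ∃ V : ℝ, Tendsto (fun e : ℕ => (N (p ^ e) : ℝ) / (p : ℝ) ^ (e * d)) atTop (𝓝 V) := by
  obtain ⟨V, hV⟩ := h
  obtain ⟨c, rfl⟩ := Nat.exists_eq_add_of_le hrd
  have hp0 : (0 : ℝ) < p := by positivity
  have h1 := hV.comp (tendsto_pow_atTop_atTop_of_one_lt (by omega : 1 < p))
  have heq : ∀ e : ℕ, (N (p ^ e) : ℝ) / (p : ℝ) ^ (e * (r + c)) =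
      (N (p ^ e) : ℝ) / ((p ^ e : ℕ) : ℝ) ^ r * (((p : ℝ)⁻¹ ^ c) ^ e) := by
    intro e
    push_cast
    rw [mul_add, pow_add, pow_mul, div_mul_eq_div_div, div_eq_mul_inv _ ((p : ℝ) ^ (e * c)),
      inv_pow, inv_pow, pow_mul' (p : ℝ) e c]
  simp_rw [heq]
  rcases Nat.eq_zero_or_pos c with rfl | hc
  · refine ⟨V * 1, h1.mul ?_⟩
    exact tendsto_const_nhds.congr fun e => by rw [pow_zero, one_pow]
  · refine ⟨V * 0, h1.mul (tendsto_pow_atTop_nhds_zero_of_lt_one (by positivity) ?_)⟩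
    refine pow_lt_one₀ (by positivity) (inv_lt_one_of_one_lt₀ ?_) hc.ne'
    exact_mod_cast (by omega : 1 < p)

end Asymptotics

/-! ### Krull dimension bounds the size of an algebraically independent family. -/

section Dimension

universe u

/-- A chain of s + 1 primes of the polynomial ring lifts to R by lying over and going up. -/
theorem natCast_le_ringKrullDim_of_isIntegral {k : Type*} [Field k] {R : Type*} [CommRing R]
    [Algebra k R] {s : ℕ} (g : MvPolynomial (Fin s) k →ₐ[k] R) (hg : Function.Injective g)
    (hint : g.IsIntegral) : (s : WithBot ℕ∞) ≤ ringKrullDim R := by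
  let _ : Algebra (MvPolynomial (Fin s) k) R := g.toRingHom.toAlgebra
  have : Algebra.IsIntegral (MvPolynomial (Fin s) k) R := ⟨hint⟩
  have hdim : ((s : ℕ) : WithBot ℕ∞) ≤ ringKrullDim (MvPolynomial (Fin s) k) := by
    rw [MvPolynomial.ringKrullDim_of_isNoetherianRing, ringKrullDim_eq_zero_of_field, zero_add,
      Nat.card_fin]
  obtain ⟨l, hl⟩ := Order.le_krullDim_iff.mp hdim
  obtain ⟨Q, -, hQ, hQl⟩ := Ideal.exists_ideal_over_prime_of_isIntegral l.head.asIdeal (⊥ : Ideal R)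
    (by
      rw [← RingHom.ker_eq_comap_bot, (RingHom.injective_iff_ker_eq_bot
        (algebraMap (MvPolynomial (Fin s) k) R)).mp hg]
      exact bot_le)
  have : Q.LiesOver l.head.asIdeal := ⟨hQl.symm⟩
  obtain ⟨l', hl', -⟩ := Ideal.exists_ltSeries_of_hasGoingUp l Q
  exact Order.le_krullDim_iff.mpr ⟨l', hl'.trans hl⟩

theorem ringKrullDim_lt_top_of_finiteType (k : Type*) [Field k] (R : Type*) [CommRing R]
    [Algebra k R] [h : Algebra.FiniteType k R] : ringKrullDim R < ⊤ := by
  obtain ⟨m, f, hf⟩ := Algebra.FiniteType.iff_quotient_mvPolynomial''.mp h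
  refine (ringKrullDim_le_of_surjective f.toRingHom hf).trans_lt ?_
  rw [MvPolynomial.ringKrullDim_of_isNoetherianRing, ringKrullDim_eq_zero_of_field, zero_add]
  exact WithBot.coe_lt_coe.mpr (ENat.natCast_lt_top _)

/-- Noether normalization gives a polynomial subring in s variables over which R is integral, so r ≤
trdeg R = s ≤ dim R. -/
theorem le_dim_of_algebraicIndependent {k R : Type u} [Field k] [CommRing R] [IsDomain R]
    [Algebra k R] [Algebra.FiniteType k R] {r : ℕ} {x : Fin r → R}
    (hx : AlgebraicIndependent k x) : r ≤ dim R := by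
  obtain ⟨s, g, hg, hint⟩ := exists_integral_inj_algHom_of_fg k R
  have hs := natCast_le_ringKrullDim_of_isIntegral g hg hint
  have hrs : r ≤ s := by
    let _ : Algebra (MvPolynomial (Fin s) k) R := g.toRingHom.toAlgebra
    have : IsScalarTower k (MvPolynomial (Fin s) k) R := .of_algHom g
    have : Algebra.IsIntegral (MvPolynomial (Fin s) k) R := ⟨hint⟩
    have : FaithfulSMul (MvPolynomial (Fin s) k) R :=
      (faithfulSMul_iff_algebraMap_injective _ _).mpr hg
    have htr := trdeg_add_eq k (MvPolynomial (Fin s) k) (A := R)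
    rw [trdeg_eq_zero (R := MvPolynomial (Fin s) k), add_zero,
      MvPolynomial.trdeg_of_isDomain] at htr
    have := hx.lift_cardinalMk_le_trdeg
    rw [← htr] at this
    simpa using this
  refine hrs.trans ?_
  have htop := ringKrullDim_lt_top_of_finiteType k R
  rw [dim]
  -- At ⊥ and ⊤ the number `dim` defaults to 0; `hs` and `htop` exclude these values.
  generalize ringKrullDim R = D at hs htop
  induction D with
  | bot => simp at hs
  | coe D =>
    induction D with
    | top => simp at htop
    | coe D => simpa using hs

end Dimension

/-! ### The rank of the lattice is at most dim k[S]. -/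

section MonomialDimension

variable {k : Type*} [Field k] {n : ℕ} {S : AddSubmonoid (Fin n →₀ ℕ)}

theorem finiteType_monomialSubring (k : Type*) [Field k] (hS : S.FG) :
    Algebra.FiniteType k (monomialSubring k S) := by
  classical
  obtain ⟨T, rfl⟩ := hS
  rw [← Subalgebra.fg_iff_finiteType]
  refine ⟨T.image fun s => MvPolynomial.monomial s 1, le_antisymm ?_ ?_⟩
  · refine Algebra.adjoin_mono ?_
    rw [Finset.coe_image]
    exact Set.image_mono AddSubmonoid.subset_closure
  · refine Algebra.adjoin_le ?_
    rintro _ ⟨s, hs, rfl⟩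
    rw [SetLike.mem_coe] at hs ⊢
    induction hs using AddSubmonoid.closure_induction with
    | mem s hs =>
      exact Algebra.subset_adjoin (Finset.mem_coe.mpr (Finset.mem_image_of_mem _ hs))
    | zero => exact Subalgebra.one_mem _
    | add s t _ _ hs ht =>
      have := Subalgebra.mul_mem _ hs ht
      simpa [MvPolynomial.monomial_mul] using this

/-- Distinct monomials in the x^(σ i) have distinct exponent vectors, so no terms cancel. -/
theorem algebraicIndependent_monomial {ι : Type*} [Fintype ι] {σ : ι → Fin n →₀ ℕ}
    (hσ : LinearIndependent ℤ fun i => intVec (σ i)) :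
    AlgebraicIndependent k fun i => MvPolynomial.monomial (σ i) (1 : k) := by
  classical
  have hinj : Function.Injective fun c : ι →₀ ℕ => ∑ i, c i • σ i := by
    intro c d h
    have h' := congrArg intVec h
    simp only [map_sum, map_nsmul] at h'
    have := linearIndependent_iff_injective_fintypeLinearCombination.mp hσ
      (a₁ := fun i => (c i : ℤ)) (a₂ := fun i => (d i : ℤ))
      (by simpa [Fintype.linearCombination_apply] using h')
    ext i
    exact_mod_cast congrFun this i
  have haeval : ∀ f : MvPolynomial ι k,
      MvPolynomial.aeval (fun i => MvPolynomial.monomial (σ i) (1 : k)) f =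
        ∑ c ∈ f.support, MvPolynomial.monomial (∑ i, c i • σ i) (f.coeff c) := by
    intro f
    rw [MvPolynomial.aeval_def, MvPolynomial.eval₂_eq']
    refine Finset.sum_congr rfl fun c _ => ?_
    simp_rw [MvPolynomial.monomial_pow, one_pow]
    rw [← MvPolynomial.monomial_sum_one, MvPolynomial.algebraMap_eq, MvPolynomial.C_mul_monomial,
      mul_one]
  rw [algebraicIndependent_iff]
  intro f hf
  ext c
  rw [haeval] at hf
  have := congrArg (MvPolynomial.coeff (∑ i, c i • σ i)) hf
  rw [MvPolynomial.coeff_sum, MvPolynomial.coeff_zero] at this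
  simp_rw [MvPolynomial.coeff_monomial, hinj.eq_iff] at this
  rw [Finset.sum_ite_eq'] at this
  rw [MvPolynomial.coeff_zero]
  by_contra hc
  rw [if_pos (MvPolynomial.mem_support_iff.mpr hc)] at this
  exact hc this

theorem exists_linearIndependent_of_mem_span {K V : Type*} [Field K] [AddCommGroup V] [Module K V]
    [FiniteDimensional K V] {X : Set V} {r : ℕ} {w : Fin r → V} (hw : LinearIndependent K w)
    (hX : ∀ i, w i ∈ Submodule.span K X) :
    ∃ σ : Fin r → V, (∀ i, σ i ∈ X) ∧ LinearIndependent K σ := by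
  obtain ⟨B, hBX, hspan, hB⟩ := exists_linearIndependent K X
  have hfin : Finite B := hB.finite
  have := Fintype.ofFinite B
  have hcard : r ≤ Fintype.card B := by
    have h1 : LinearIndependent K fun i => (⟨w i, hX i⟩ : Submodule.span K X) :=
      LinearIndependent.of_comp (Submodule.span K X).subtype hw
    have h2 := h1.fintype_card_le_finrank
    have h3 := finrank_span_eq_card hB
    rw [Subtype.range_coe, hspan] at h3
    rwa [Fintype.card_fin, h3] at h2
  obtain ⟨ι⟩ : Nonempty (Fin r ↪ B) :=
    Function.Embedding.nonempty_of_card_le (by simpa using hcard)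
  exact ⟨fun i => ι i, fun i => hBX (ι i).2, hB.comp ι ι.injective⟩

/-- A lattice basis need not lie in S, but S spans the same ℚ-space, since lattice vectors are
differences of elements of S. -/
theorem exists_linearIndependent_of_lattice {r : ℕ} {v : Fin r → Fin n → ℤ}
    (hv : LinearIndependent ℤ v) (hL : ∀ i, v i ∈ lattice S) :
    ∃ σ : Fin r → Fin n →₀ ℕ, (∀ i, σ i ∈ S) ∧ LinearIndependent ℤ fun i => intVec (σ i) := by
  have hvQ : LinearIndependent ℚ fun i => algebraMap ℤ ℚ ∘ v i :=
    linearIndependent_algebraMap_comp_iff.mpr hv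
  obtain ⟨w, hw, hind⟩ := exists_linearIndependent_of_mem_span
    (X := (fun s => algebraMap ℤ ℚ ∘ intVec s) '' (S : Set (Fin n →₀ ℕ))) hvQ fun i => by
      obtain ⟨a, ha, b, hb, hab⟩ := exists_sub_of_mem_lattice S (hL i)
      have : algebraMap ℤ ℚ ∘ v i = algebraMap ℤ ℚ ∘ intVec a - algebraMap ℤ ℚ ∘ intVec b := by
        rw [hab]
        exact funext fun j => map_sub (algebraMap ℤ ℚ) _ _
      rw [this]
      exact sub_mem (Submodule.subset_span ⟨a, ha, rfl⟩) (Submodule.subset_span ⟨b, hb, rfl⟩)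
  choose σ hσ hσw using hw
  refine ⟨σ, hσ, (linearIndependent_algebraMap_comp_iff (S := ℚ)).mp ?_⟩
  rwa [show (fun i => algebraMap ℤ ℚ ∘ intVec (σ i)) = w from funext hσw]

theorem rank_le_dim (k : Type*) [Field k] (hS : S.FG) {r : ℕ} {v : Fin r → Fin n → ℤ}
    (hv : LinearIndependent ℤ v) (hL : ∀ i, v i ∈ lattice S) : r ≤ dim (monomialSubring k S) := by
  obtain ⟨σ, hσ, hind⟩ := exists_linearIndependent_of_lattice hv hL
  have := finiteType_monomialSubring k hS
  let x : Fin r → monomialSubring k S := fun i =>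
    ⟨MvPolynomial.monomial (σ i) 1, monomial_mem_monomialSubring (hσ i) 1⟩
  have hx : AlgebraicIndependent k x :=
    AlgebraicIndependent.of_comp (monomialSubring k S).val (algebraicIndependent_monomial hind)
  exact le_dim_of_algebraicIndependent hx

theorem exists_tendsto_ncard_box (k : Type*) [Field k] (hfg : S.FG) (hS : IsFull S) {p : ℕ}
    (hp : 2 ≤ p) :
    ∃ V : ℝ, Tendsto (fun e : ℕ => ((box S (p ^ e)).ncard : ℝ) /
      (p : ℝ) ^ (e * dim (monomialSubring k S))) atTop (𝓝 V) := by
  obtain ⟨r, v, hv, hL⟩ := exists_basis_lattice S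
  have hmem : ∀ i, v i ∈ lattice S := fun i =>
    (hL _).mpr ⟨Pi.single i 1, by simp [Pi.single_apply]⟩
  exact tendsto_div_pow_of_tendsto_div_pow (N := fun q => (box S q).ncard) hp
    (rank_le_dim k hfg hv hmem) (tendsto_ncard_box_div_pow hS hv hL)

end MonomialDimension

end MonomialRing

theorem mainTheorem6 {k : Type*} [Field k] [PerfectField k] (p : ℕ) [Fact p.Prime] [CharP k p]
    {n : ℕ} (S : AddSubmonoid (Fin n →₀ ℕ)) (hfg : S.FG)
    (hfull : MonomialRing.IsFull S) (hstar : MonomialRing.PropertyStar S) :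
    (∀ e : ℕ, ∃! a : ℕ,
      MonomialRing.IsFreeRank (MonomialRing.monomialSubring k S)
        (MonomialRing.homogeneousElements k p e S) a) ∧
    (∀ e : ℕ,
      (MonomialRing.frobeniusFreeRank k p S e : ℕ∞) = MonomialRing.bracketLength k S (p ^ e)) ∧
    Tendsto (fun e : ℕ => (MonomialRing.frobeniusFreeRank k p S e : ℝ) /
        (p : ℝ) ^ (e * MonomialRing.dim (MonomialRing.monomialSubring k S)))
      atTop (𝓝 (MonomialRing.fSignature k p S)) ∧
    Tendsto (fun e : ℕ => ((MonomialRing.bracketLength k S (p ^ e)).toNat : ℝ) /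
        (p : ℝ) ^ (e * MonomialRing.dim (MonomialRing.monomialSubring k S)))
      atTop (𝓝 (MonomialRing.fSignature k p S)) := by
  have hrank := fun e =>
    MonomialRing.frobeniusFreeRank_eq_ncard_box (k := k) (p := p) (e := e) hfull hstar
  have hlen := MonomialRing.bracketLength_eq_ncard_box k S p
  have hlim : Tendsto (fun e : ℕ => (MonomialRing.frobeniusFreeRank k p S e : ℝ) /
      (p : ℝ) ^ (e * MonomialRing.dim (MonomialRing.monomialSubring k S)))
      atTop (𝓝 (MonomialRing.fSignature k p S)) := by
    -- The F-signature is a `limUnder`, so it is enough that some limit exists.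
    refine tendsto_nhds_limUnder ?_
    obtain ⟨V, hV⟩ := MonomialRing.exists_tendsto_ncard_box k hfg hfull
      (Fact.out : p.Prime).two_le
    exact ⟨V, hV.congr fun e => by rw [(hrank e).2]⟩
  refine ⟨fun e => (hrank e).1, fun e => ?_, hlim, hlim.congr fun e => ?_⟩
  · rw [hlen, (hrank e).2]
  · rw [hlen, (hrank e).2, ENat.toNat_natCast]
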